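/- Let $T$ be an arbitrary set. All processes $X=\{X_t\}_{t\in T}$ are real-valued stochastic processes on some probability space, and $\mathcal F(T)$ denotes the set of finite subsets of $T$. **Tail correlation functions.** Let $X$ have identical one-dimensional marginal distributions, with upper endpoint (essential supremum) $\tau_{\mathrm{up}}\in(-\infty,\infty]$. Its tail correlation function (TCF) is $$\chi^{(X)}(s,t)=\lim_{\tau\uparrow\tau_{\mathrm{up}}}\mathbb P(X_s>\tau\mid X_t>\tau),\qquad s,t\in T,$$ provided that these limits exist. **Max-stable processes and extremal coefficients.** $X$ is *simple max-stable* if $\mathbb P(X_t\le x)=e^{-1/x}$ for all $t\in T$, $x>0$, and if for every $n\ge1$ the pointwise maximum of $n$ independent copies of $X$ has the same finite-dimensional distributions as $nX$. Its *extremal coefficient function* $\theta^{(X)}:\mathcal F(T)\to\mathbb R$ is given by $\theta^{(X)}(\emptyset)=0$ and, for $A\ne\emptyset$, $\theta^{(X)}(A)=-\tau\log\mathbb P(\max_{t\in A}X_t\le\tau)$, which does not depend on $\tau>0$. Let $\Theta(T)$ be the set of all $\theta^{(X)}$ with $X$ simple max-stable on $T$, let $\Theta_b(T)$ be the set of bounded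 $\theta\in\Theta(T)$, and let $$\psi:\mathbb R^{\mathcal F(T)}\to\mathbb R^{T\times T},\qquad \psi(F)(s,t)=2-F(\{s,t\}).$$ **Tawn–Molchanov processes.** $X$ is a *Tawn–Molchanov (TM) process* if there is $\theta\in\Theta(T)$ such that for all finite $A\subset T$ and all $x_t>0$ ($t\in A$) $$-\log\mathbb P(X_t\le x_t,\ t\in A)=\sum_{\emptyset\ne L\subset A}\Big(-\sum_{I\subset L}(-1)^{|I|}\,\theta\big((A\setminus L)\cup I\big)\Big)\max_{t\in L}x_t^{-1}.$$ **Classes of functions on $T\times T$.** - $\mathrm{TCF}(T)$: all $\chi^{(X)}$, where $X$ has identical one-dimensional margins and $\chi^{(X)}$ exists. - $\mathrm{TCF}_\infty(T)$, $\mathrm{MAX}(T)$, $\mathrm{TM}(T)$: those $\chi^{(X)}\in\mathrm{TCF}(T)$ for which $X$ can be chosen, respectively, with margins of essential supremum $\infty$, simple max-stable, or a TM process. - $\mathrm{BIN}(T)$: all functions $(s,t)\mapsto\mathbb P(Y_s=1\mid Y_t=1)$, where $Y$ is a $\{0,1\}$-valued process on $T$ with identical one-dimensional margins and $\mathbb E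 Y_t\neq0$. **Theorem.** (a) For an arbitrary set $T$, $\mathrm{BIN}(T)=\psi(\Theta_b(T))$ and $$\mathrm{TCF}(T)=\mathrm{TCF}_\infty(T)=\mathrm{MAX}(T)=\mathrm{TM}(T)=\psi(\Theta(T)),$$ and this set equals both the sequential closure (the set of limits of sequences) and the closure of $\mathrm{BIN}(T)$ with respect to pointwise convergence in $\mathbb R^{T\times T}$. (b) If $T$ is infinite, then $\mathrm{BIN}(T)\subsetneq\mathrm{TCF}(T)$. (c) If $M$ is a finite set, then $\mathrm{BIN}(M)=\mathrm{TCF}(M)$. -/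

import Mathlib

open MeasureTheory ProbabilityTheory Filter Topology

universe u

namespace TailCorrelation

noncomputable section

/-- `X` is a real-valued stochastic process indexed by `T` on the probability space `(Ω, P)`. -/
structure IsProcess {T Ω : Type u} [MeasurableSpace Ω] (P : Measure Ω) (X : T → Ω → ℝ) :
    Prop where
  prob : IsProbabilityMeasure P
  meas : ∀ t, Measurable (X t)

/-- Identical one-dimensional marginal distributions. -/
def IdenticalMargins {T Ω : Type u} [MeasurableSpace Ω] (P : Measure Ω) (X : T → Ω → ℝ) : Prop :=
  ∀ s t, IdentDistrib (X s) (X t) P P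

/-- Two processes have the same finite-dimensional distributions. -/
def SameFDD {T Ω Ω' : Type u} [MeasurableSpace Ω] [MeasurableSpace Ω']
    (P : Measure Ω) (X : T → Ω → ℝ) (Q : Measure Ω') (Y : T → Ω' → ℝ) : Prop :=
  ∀ A : Finset T, IdentDistrib (fun ω (t : A) => X t ω) (fun ω (t : A) => Y t ω) P Q

/-- The upper endpoint (essential supremum) in `(-∞, ∞]` of the law of a real random variable. -/
def upperEndpoint {Ω : Type u} [MeasurableSpace Ω] (P : Measure Ω) (Z : Ω → ℝ) : EReal :=
  essSup (fun ω => (Z ω : EReal)) P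

/-- The filter of real thresholds `τ → e`, `τ < e`, for an endpoint `e` that may be `∞`. -/
def belowEndpoint (e : EReal) : Filter ℝ :=
  comap (fun τ : ℝ => (τ : EReal)) (𝓝[<] e)

/-- `χ` is the tail correlation function of `X`: the process has identical one-dimensional
margins and, for all `s, t`, the limit of `P(X_s > τ | X_t > τ)`, as `τ` increases to the common
upper endpoint of the margins, exists and equals `χ (s, t)`. -/
structure HasTCF {T Ω : Type u} [MeasurableSpace Ω] (P : Measure Ω) (X : T → Ω → ℝ)
    (χ : T × T → ℝ) : Prop where
  margins : IdenticalMargins P X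
  tendsto : ∀ s t, Tendsto (fun τ : ℝ => (P[|{ω | τ < X t ω}]).real {ω | τ < X s ω})
    (belowEndpoint (upperEndpoint P (X t))) (𝓝 (χ (s, t)))

/-- Simple max-stable processes: unit Fréchet margins, and for every `n ≥ 1` the pointwise maximum
of `n` independent copies of `X` (realized on the `n`-fold product of the underlying probability
space) has the same finite-dimensional distributions as `n X`. -/
structure IsSimpleMaxStable {T Ω : Type u} [MeasurableSpace Ω] (P : Measure Ω)
    (X : T → Ω → ℝ) : Prop where
  process : IsProcess P X
  frechet : ∀ t, ∀ x : ℝ, 0 < x → P.real {ω | X t ω ≤ x} = Real.exp (-1 / x)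
  maxStable : ∀ n : ℕ, 1 ≤ n →
    SameFDD (Measure.pi (fun _ : Fin n => P)) (fun t ω => ⨆ i : Fin n, X t (ω i))
      P (fun t ω => (n : ℝ) * X t ω)

/-- `θ` is the extremal coefficient function of `X`: `θ(∅) = 0` and
`θ(A) = -τ log P(max_{t ∈ A} X_t ≤ τ)`, for every `τ > 0`, if `A ≠ ∅`. -/
structure IsECF {T Ω : Type u} [MeasurableSpace Ω] (P : Measure Ω) (X : T → Ω → ℝ)
    (θ : Finset T → ℝ) : Prop where
  empty : θ ∅ = 0
  eq : ∀ A : Finset T, A.Nonempty → ∀ τ : ℝ, 0 < τ →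
    θ A = -τ * Real.log (P.real {ω | ∀ t ∈ A, X t ω ≤ τ})

/-- The set of extremal coefficient functions of simple max-stable processes on `T`. -/
def Theta (T : Type u) : Set (Finset T → ℝ) :=
  {θ | ∃ (Ω : Type u) (_ : MeasurableSpace Ω) (P : Measure Ω) (X : T → Ω → ℝ),
    IsSimpleMaxStable P X ∧ IsECF P X θ}

/-- The bounded extremal coefficient functions. -/
def ThetaB (T : Type u) : Set (Finset T → ℝ) :=
  {θ | θ ∈ Theta T ∧ ∃ κ : ℝ, ∀ A, |θ A| ≤ κ}

open scoped Classical in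
/-- `ψ(F)(s, t) = 2 - F({s, t})`. -/
def psi (T : Type u) (F : Finset T → ℝ) : T × T → ℝ :=
  fun p => 2 - F {p.1, p.2}

open scoped Classical in
/-- `(Δ_{t₁} ⋯ Δ_{tₖ} f)(K)` for `L = {t₁, …, tₖ}`, where `(Δ_t f)(K) = f(K) - f(K ∪ {t})`,
written out as an alternating sum over the subsets of `L`. -/
def iterDelta {T : Type u} (f : Finset T → ℝ) (L K : Finset T) : ℝ :=
  ∑ I ∈ L.powerset, (-1 : ℝ) ^ I.card * f (K ∪ I)

open scoped Classical in
/-- `X` is a Tawn–Molchanov process associated with the extremal coefficient function `θ`: for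
every finite `A ⊆ T` and all levels `x_t > 0`,
`-log P(X_t ≤ x_t, t ∈ A) = ∑_{∅ ≠ L ⊆ A} (-Δ_L θ)(A \ L) max_{t ∈ L} 1 / x_t`. -/
structure IsTMProcess {T Ω : Type u} [MeasurableSpace Ω] (P : Measure Ω) (X : T → Ω → ℝ)
    (θ : Finset T → ℝ) : Prop where
  process : IsProcess P X
  ecf : θ ∈ Theta T
  fdd : ∀ (A : Finset T) (x : T → ℝ), (∀ t ∈ A, 0 < x t) →
    P.real {ω | ∀ t ∈ A, X t ω ≤ x t} =
      Real.exp (-∑ L ∈ A.powerset with L.Nonempty,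
        -iterDelta θ L (A \ L) * ⨆ t : L, (x t)⁻¹)

/-- All tail correlation functions on `T`. Since every process has a copy on the path space
`T → ℝ`, nothing is lost by taking the probability spaces in the universe of `T`. -/
def TCF (T : Type u) : Set (T × T → ℝ) :=
  {χ | ∃ (Ω : Type u) (_ : MeasurableSpace Ω) (P : Measure Ω) (X : T → Ω → ℝ),
    IsProcess P X ∧ HasTCF P X χ}

/-- Tail correlation functions of processes whose margins have essential supremum `∞`. -/
def TCFInf (T : Type u) : Set (T × T → ℝ) :=
  {χ | ∃ (Ω : Type u) (_ : MeasurableSpace Ω) (P : Measure Ω) (X : T → Ω → ℝ),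
    IsProcess P X ∧ HasTCF P X χ ∧ ∀ t, upperEndpoint P (X t) = ⊤}

/-- Tail correlation functions of simple max-stable processes. -/
def MAX (T : Type u) : Set (T × T → ℝ) :=
  {χ | ∃ (Ω : Type u) (_ : MeasurableSpace Ω) (P : Measure Ω) (X : T → Ω → ℝ),
    IsSimpleMaxStable P X ∧ HasTCF P X χ}

/-- Tail correlation functions of Tawn–Molchanov processes. -/
def TM (T : Type u) : Set (T × T → ℝ) :=
  {χ | ∃ (Ω : Type u) (_ : MeasurableSpace Ω) (P : Measure Ω) (X : T → Ω → ℝ)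
    (θ : Finset T → ℝ), IsTMProcess P X θ ∧ HasTCF P X χ}

/-- The functions `(s, t) ↦ P(Y_s = 1 | Y_t = 1)` of `{0,1}`-valued processes `Y` with identical
one-dimensional margins and `E Y_t ≠ 0`. -/
def BIN (T : Type u) : Set (T × T → ℝ) :=
  {f | ∃ (Ω : Type u) (_ : MeasurableSpace Ω) (P : Measure Ω) (Y : T → Ω → ℝ),
    IsProcess P Y ∧ IdenticalMargins P Y ∧ (∀ t ω, Y t ω = 0 ∨ Y t ω = 1) ∧
    (∀ t, ∫ ω, Y t ω ∂P ≠ 0) ∧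
    f = fun p => (P[|{ω | Y p.2 ω = 1}]).real {ω | Y p.1 ω = 1}}

end

end TailCorrelation

/-! Every class is trapped in one cycle of inclusions: `TCF T` ⊆ `seqClosure (BIN T)` ⊆ `closure
(BIN T)` ⊆ `psi T '' Theta T` ⊆ `MAX T ∩ TCFInf T ∩ TM T`, each of these last three lying in `TCF
T`. The first inclusion holds because the indicators of `X_t > τ` form a binary process, and `τ` can
run to the endpoint along a sequence.

The engine is `mem_Theta_iff`: extremal coefficient functions are exactly the normalized completely
alternating set functions. Necessity: `τ P(max_A X > τ) → θ(A)`, capacity functionals are completely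
alternating, and the sign conditions survive limits. Sufficiency: the numbers `w_A(L) = -Δ_L θ(A \
L)` with `L ≠ ∅` are nonnegative and behave like masses of a random subset of `A`, consistent under
intersection with smaller sets. Independent unit Fréchet variables `z_L` give `X_t = max_{L ∋ t}
w_A(L) z_L` on each finite `A`; these laws are projective and extend to `T`, giving a process that
is both simple max-stable and Tawn–Molchanov.

Being completely alternating is a closed condition and forces `0 ≤ θ(A) ≤ |A|`, so these functions
form a compact set by Tychonoff. As `psi` is continuous, `psi T '' Theta T` is closed. It contains
`BIN T`, because hitting probabilities divided by `P(Y_t = 1)` are bounded completely alternating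
functions. Conversely a bounded `θ`, suitably scaled, is the capacity functional of a random set,
whence `BIN T = psi T '' ThetaB T`.

For infinite `T`, `θ(A) = |A|` separates the classes; for finite `T` every `θ` is bounded. -/

open scoped ENNReal NNReal

namespace TailCorrelation

/-! ### Kolmogorov extension for real-valued families. -/

section Extension

variable {ι : Type*} {P : ∀ J : Finset ι, Measure (J → ℝ)}

/-- A sequence of compact cylinders with the finite intersection property has a common point. -/
lemma nonempty_iInter_cylinder_of_isCompact {J : ℕ → Finset ι} {K : ∀ n, Set (J n → ℝ)}
    (hK : ∀ n, IsCompact (K n))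
    (h : ∀ n, (⋂ i ≤ n, cylinder (α := fun _ => ℝ) (J i) (K i)).Nonempty) :
    (⋂ n, cylinder (α := fun _ => ℝ) (J n) (K n)).Nonempty := by
  choose x hx using h
  have hmem : ∀ m n, m ≤ n → (J m).restrict (x n) ∈ K m := fun m n hmn => by
    have := hx n
    simp only [Set.mem_iInter] at this
    exact this m hmn
  -- One fixed ultrafilter makes all the restrictions converge at once and replaces a diagonal
  -- subsequence.
  have hlim : ∀ m, ∃ y ∈ K m,
      Tendsto (fun n => (J m).restrict (x n)) (hyperfilter ℕ : Filter ℕ) (𝓝 y) := fun m => by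
    have := (hK m).ultrafilter_le_nhds ((hyperfilter ℕ).map fun n => (J m).restrict (x n)) (by
      rw [le_principal_iff]
      refine hyperfilter_le_cofinite ?_
      rw [Nat.cofinite_eq_atTop]
      exact (eventually_ge_atTop m).mono fun n hn => hmem m n hn)
    exact this
  choose y hyK hy using hlim
  -- Uniqueness of limits makes this agree with every `y m`; at indices lying in no `J m` the value
  -- is irrelevant.
  let z : ι → ℝ := fun t => limUnder (hyperfilter ℕ : Filter ℕ) fun n => x n t
  refine ⟨z, Set.mem_iInter.2 fun m => ?_⟩
  have : (J m).restrict z = y m := by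
    funext t
    exact ((tendsto_pi_nhds.1 (hy m)) t).limUnder_eq
  rw [mem_cylinder, this]
  exact hyK m

/-- If the contents stayed above some `ε > 0`, inner regularity would give compact cylinders inside
`s n` with errors summing to less than `ε`. Their finite intersections would be nonempty, since
otherwise the discarded pieces would cover `s n`; compactness would then give a point of `⋂ n, s n`.
-/
lemma tendsto_projectiveFamilyContent_zero [∀ J, IsFiniteMeasure (P J)]
    (hP : IsProjectiveMeasureFamily (α := fun _ => ℝ) P) {s : ℕ → Set (ι → ℝ)}
    (hs : ∀ n, s n ∈ measurableCylinders fun _ => ℝ) (hanti : Antitone s)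
    (hempty : ⋂ n, s n = ∅) :
    Tendsto (fun n => projectiveFamilyContent hP (s n)) atTop (𝓝 0) := by
  have hmono : Antitone fun n => projectiveFamilyContent hP (s n) := fun m n hmn =>
    projectiveFamilyContent_mono hP (hs n) (hs m) (hanti hmn)
  have hlim := tendsto_atTop_iInf hmono
  set ε := ⨅ n, projectiveFamilyContent hP (s n) with hε
  by_cases hε0 : ε = 0
  · rwa [hε0] at hlim
  exfalso
  obtain ⟨δ, hδ, hsum⟩ := ENNReal.exists_pos_sum_of_countable' hε0 ℕ
  choose J S hS hsJ using fun n => (mem_measurableCylinders _).1 (hs n)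
  have hK : ∀ n, ∃ K ⊆ S n, IsCompact K ∧ P (J n) (S n \ K) < δ n := fun n =>
    (hS n).exists_isCompact_sdiff_lt (measure_ne_top _ _) (hδ n).ne'
  choose K hKS hKc hKδ using hK
  have hcyl : ∀ n, s n \ cylinder (J n) (K n) = cylinder (α := fun _ => ℝ) (J n) (S n \ K n) :=
    fun n => by rw [hsJ n]; exact (Set.preimage_sdiff _ _ _).symm
  have hmeas : ∀ n, MeasurableSet (S n \ K n) := fun n => (hS n).diff (hKc n).measurableSet
  have hmem : ∀ n, s n \ cylinder (J n) (K n) ∈ measurableCylinders (fun _ : ι => ℝ) := fun n => by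
    rw [hcyl n]
    exact cylinder_mem_measurableCylinders _ _ (hmeas n)
  have hne : ∀ n, (⋂ i ≤ n, cylinder (α := fun _ => ℝ) (J i) (K i)).Nonempty := fun n => by
    by_contra hcon
    rw [Set.not_nonempty_iff_eq_empty] at hcon
    have hsub : s n ⊆ ⋃ i ≤ n, s i \ cylinder (α := fun _ => ℝ) (J i) (K i) := fun ω hω => by
      have : ω ∉ ⋂ i ≤ n, cylinder (α := fun _ => ℝ) (J i) (K i) := by rw [hcon]; exact id
      simp only [Set.mem_iInter, not_forall] at this
      obtain ⟨i, hi, hωi⟩ := this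
      exact Set.mem_iUnion₂.2 ⟨i, hi, hanti hi hω, hωi⟩
    have hU : (⋃ i ≤ n, s i \ cylinder (α := fun _ => ℝ) (J i) (K i)) ∈
        measurableCylinders (fun _ : ι => ℝ) := by
      have h := isSetRing_measurableCylinders.biUnion_mem (Finset.range (n + 1))
        (s := fun i => s i \ cylinder (α := fun _ => ℝ) (J i) (K i)) fun i _ => hmem i
      simpa only [Finset.mem_range_succ_iff] using h
    refine lt_irrefl ε ?_
    calc ε ≤ projectiveFamilyContent hP (s n) := iInf_le _ n
      _ ≤ projectiveFamilyContent hP (⋃ i ≤ n, s i \ cylinder (J i) (K i)) :=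
        projectiveFamilyContent_mono hP (hs n) hU hsub
      _ ≤ ∑ i ∈ Finset.range (n + 1), projectiveFamilyContent hP (s i \ cylinder (J i) (K i)) :=
        projectiveFamilyContent_iUnion_le hP hmem n
      _ ≤ ∑ i ∈ Finset.range (n + 1), δ i := Finset.sum_le_sum fun i _ => by
        rw [hcyl i, projectiveFamilyContent_cylinder hP (hmeas i)]
        exact (hKδ i).le
      _ ≤ ∑' i, δ i := ENNReal.sum_le_tsum _
      _ < ε := hsum
  obtain ⟨ω, hω⟩ := nonempty_iInter_cylinder_of_isCompact hKc hne
  have : ω ∈ ⋂ n, s n := Set.mem_iInter.2 fun n => by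
    rw [hsJ n]
    exact hKS n (Set.mem_iInter.1 hω n)
  rw [hempty] at this
  exact this

/-- Kolmogorov's extension theorem for families of real random variables. -/
theorem exists_isProjectiveLimit [∀ J, IsFiniteMeasure (P J)]
    (hP : IsProjectiveMeasureFamily (α := fun _ => ℝ) P) :
    ∃ μ : Measure (ι → ℝ), IsProjectiveLimit μ P := by
  have hsub : (projectiveFamilyContent hP).IsSigmaSubadditive :=
    isSigmaSubadditive_of_addContent_iUnion_eq_tsum isSetRing_measurableCylinders
      fun f hf hfU hf' => addContent_iUnion_eq_sum_of_tendsto_zero isSetRing_measurableCylinders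
        (projectiveFamilyContent hP) (fun _ _ => projectiveFamilyContent_ne_top _)
        (fun _ => tendsto_projectiveFamilyContent_zero hP) hf hfU hf'
  refine ⟨(projectiveFamilyContent hP).measure isSetSemiring_measurableCylinders
    generateFrom_measurableCylinders.ge hsub, fun I => ?_⟩
  ext s hs
  rw [Measure.map_apply (Finset.measurable_restrict I) hs, AddContent.measure_eq, ← cylinder,
    projectiveFamilyContent_cylinder hP hs]
  · exact generateFrom_measurableCylinders.symm
  · exact cylinder_mem_measurableCylinders _ _ hs

end Extension

/-! ### Completely alternating set functions and their weights. -/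

section Alternating

open scoped Classical

variable {T : Type u}

/-- Normalized completely alternating functions on finite sets. -/
structure IsCompletelyAlternating (θ : Finset T → ℝ) : Prop where
  empty : θ ∅ = 0
  singleton : ∀ t, θ {t} = 1
  iterDelta_nonpos : ∀ L K : Finset T, L.Nonempty → Disjoint L K → iterDelta θ L K ≤ 0

lemma iterDelta_empty (f : Finset T → ℝ) (K : Finset T) : iterDelta f ∅ K = f K := by
  simp [iterDelta]

lemma iterDelta_insert (f : Finset T → ℝ) {s : T} {L : Finset T} (hs : s ∉ L) (K : Finset T) :
    iterDelta f (insert s L) K = iterDelta f L K - iterDelta f L (insert s K) := by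
  unfold iterDelta
  rw [Finset.sum_powerset_insert hs, sub_eq_add_neg, ← Finset.sum_neg_distrib]
  congr 1
  refine Finset.sum_congr rfl fun I hI => ?_
  have hsI : s ∉ I := fun h => hs (Finset.mem_powerset.1 hI h)
  rw [Finset.card_insert_of_notMem hsI, pow_succ, Finset.union_insert, Finset.insert_union]
  ring

/-- The weight of the subset `L` of the finite set `A`: for completely alternating `f` these are
the masses of a random subset of `A`. -/
noncomputable def weight (f : Finset T → ℝ) (A L : Finset T) : ℝ := -iterDelta f L (A \ L)

/-- The formal weight of `∅` may be negative. Keeping it in the sums makes the consistency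
identities exact for arbitrary `f`. -/
lemma weight_empty (f : Finset T → ℝ) (A : Finset T) : weight f A ∅ = -f A := by
  simp [weight, iterDelta_empty]

lemma weight_nonneg {θ : Finset T → ℝ} (hθ : IsCompletelyAlternating θ) (A : Finset T)
    {L : Finset T} (hL : L.Nonempty) : 0 ≤ weight θ A L :=
  neg_nonneg.2 (hθ.iterDelta_nonpos L _ hL Finset.disjoint_sdiff)

/-- A subset of `insert s B` meets `B` in `M` exactly when it is `M` or `insert s M`; this is
one-point marginal consistency. -/
lemma weight_insert_add (f : Finset T → ℝ) {s : T} {B M : Finset T} (hs : s ∉ B) (hM : M ⊆ B) :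
    weight f (insert s B) M + weight f (insert s B) (insert s M) = weight f B M := by
  have hsM : s ∉ M := fun h => hs (hM h)
  unfold weight
  rw [iterDelta_insert f hsM, Finset.insert_sdiff_of_notMem _ hsM,
    Finset.insert_sdiff_insert, Finset.sdiff_insert_of_notMem hs]
  ring

lemma sum_weight_insert (f g : Finset T → ℝ) {s : T} {B : Finset T} (hs : s ∉ B)
    (hg : ∀ M ⊆ B, g (insert s M) = g M) :
    ∑ L ∈ (insert s B).powerset, weight f (insert s B) L * g L =
      ∑ M ∈ B.powerset, weight f B M * g M := by
  rw [Finset.sum_powerset_insert hs, ← Finset.sum_add_distrib]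
  refine Finset.sum_congr rfl fun M hM => ?_
  have hM := Finset.mem_powerset.1 hM
  rw [hg M hM, ← weight_insert_add f hs hM]
  ring

/-- The weights on `A` are projected to the weights on `B` by intersection with `B`. -/
lemma sum_weight_inter (f g : Finset T → ℝ) {A B : Finset T} (hBA : B ⊆ A) :
    ∑ L ∈ A.powerset, weight f A L * g (L ∩ B) = ∑ M ∈ B.powerset, weight f B M * g M := by
  have key : ∀ D : Finset T, Disjoint D B →
      ∑ L ∈ (D ∪ B).powerset, weight f (D ∪ B) L * g (L ∩ B) =
        ∑ M ∈ B.powerset, weight f B M * g M := by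
    intro D
    induction D using Finset.induction_on with
    | empty =>
      intro _
      rw [Finset.empty_union]
      refine Finset.sum_congr rfl fun M hM => ?_
      rw [Finset.inter_eq_left.2 (Finset.mem_powerset.1 hM)]
    | insert s D hsD ih =>
      intro hD
      rw [Finset.disjoint_insert_left] at hD
      have hs : s ∉ D ∪ B := by
        rw [Finset.mem_union, not_or]
        exact ⟨hsD, hD.1⟩
      rw [Finset.insert_union, sum_weight_insert f (fun L => g (L ∩ B)) hs, ih hD.2]
      intro M _
      rw [Finset.insert_inter_of_notMem hD.1]
  have := key (A \ B) Finset.sdiff_disjoint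
  rwa [Finset.sdiff_union_of_subset hBA] at this

lemma sum_weight (f : Finset T → ℝ) (A : Finset T) :
    ∑ L ∈ A.powerset, weight f A L = -f ∅ := by
  have := sum_weight_inter f (fun _ => 1) (Finset.empty_subset A)
  simpa [weight_empty] using this

/-- The value at `B` is the total weight of the subsets that hit `B`. -/
lemma sum_weight_hit {f : Finset T → ℝ} (hf : f ∅ = 0) {A B : Finset T} (hBA : B ⊆ A) :
    ∑ L ∈ A.powerset, weight f A L * (if (L ∩ B).Nonempty then 1 else 0) = f B := by
  rw [sum_weight_inter f (fun L => if L.Nonempty then 1 else 0) hBA]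
  have h1 : ∀ M ∈ B.powerset, weight f B M * (if M.Nonempty then 1 else 0) =
      weight f B M - (if M = ∅ then weight f B ∅ else 0) := by
    intro M _
    rcases M.eq_empty_or_nonempty with rfl | hM
    · simp
    · simp [hM, hM.ne_empty]
  rw [Finset.sum_congr rfl h1, Finset.sum_sub_distrib, sum_weight, Finset.sum_ite_eq']
  simp [hf, weight_empty]

lemma IsCompletelyAlternating.nonneg {θ : Finset T → ℝ} (hθ : IsCompletelyAlternating θ)
    (A : Finset T) : 0 ≤ θ A := by
  rw [← sum_weight_hit hθ.empty (Finset.Subset.refl A)]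
  refine Finset.sum_nonneg fun L hL => ?_
  split_ifs with h
  · rw [mul_one]
    exact weight_nonneg hθ A (h.mono Finset.inter_subset_left)
  · rw [mul_zero]

/-- Union bound with the weights as masses: a set that hits `A` hits at least one of its points. -/
lemma IsCompletelyAlternating.le_card {θ : Finset T → ℝ} (hθ : IsCompletelyAlternating θ)
    (A : Finset T) : θ A ≤ A.card := by
  have h1 : (A.card : ℝ) = ∑ t ∈ A, θ {t} := by simp [hθ.singleton]
  rw [h1, ← sum_weight_hit hθ.empty (Finset.Subset.refl A),
    Finset.sum_congr rfl fun t ht =>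
      (sum_weight_hit hθ.empty (Finset.singleton_subset_iff.2 ht)).symm, Finset.sum_comm]
  refine Finset.sum_le_sum fun L hL => ?_
  rw [← Finset.mul_sum]
  have hLA := Finset.mem_powerset.1 hL
  rcases L.eq_empty_or_nonempty with rfl | hne
  · simp
  refine mul_le_mul_of_nonneg_left ?_ (weight_nonneg hθ A hne)
  obtain ⟨t, ht⟩ := hne
  calc (if (L ∩ A).Nonempty then 1 else 0 : ℝ) ≤ 1 := by split_ifs <;> norm_num
    _ = (if (L ∩ {t}).Nonempty then 1 else 0) := by
      rw [if_pos ⟨t, by simp [ht]⟩]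
    _ ≤ _ := Finset.single_le_sum (f := fun t => if (L ∩ {t}).Nonempty then (1 : ℝ) else 0)
      (fun i _ => by split_ifs <;> norm_num) (hLA ht)

lemma iterDelta_const_sub (f : Finset T → ℝ) (c : ℝ) {L : Finset T} (hL : L.Nonempty)
    (K : Finset T) : iterDelta (fun A => c - f A) L K = -iterDelta f L K := by
  have h := Finset.sum_powerset_neg_one_pow_card_of_nonempty hL
  have h' : ∑ m ∈ L.powerset, (-1 : ℝ) ^ m.card = 0 := by exact_mod_cast h
  unfold iterDelta
  rw [← Finset.sum_neg_distrib]
  have : ∀ I ∈ L.powerset, (-1 : ℝ) ^ I.card * (c - f (K ∪ I)) =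
      (-1 : ℝ) ^ I.card * c + -((-1 : ℝ) ^ I.card * f (K ∪ I)) := fun I _ => by ring
  rw [Finset.sum_congr rfl this, Finset.sum_add_distrib, ← Finset.sum_mul, h', zero_mul, zero_add]

lemma iterDelta_div (f : Finset T → ℝ) (c : ℝ) (L K : Finset T) :
    iterDelta (fun A => f A / c) L K = iterDelta f L K / c := by
  unfold iterDelta
  rw [Finset.sum_div]
  exact Finset.sum_congr rfl fun I _ => by ring

/-- The complementary "miss" indicator is multiplicative over points, so its alternating sum factors
as the indicator that `K` is missed times `∏_{t ∈ L} 1_{E t}`, which is nonnegative. Passing from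
miss to hit flips the sign. -/
lemma iterDelta_hit_nonpos (E : T → Prop) {L : Finset T} (hL : L.Nonempty) (K : Finset T) :
    iterDelta (fun A => if ∃ t ∈ A, E t then 1 else 0) L K ≤ 0 := by
  have h : (fun A : Finset T => if ∃ t ∈ A, E t then (1 : ℝ) else 0) =
      fun A => 1 - if ∀ t ∈ A, ¬ E t then 1 else 0 := by
    funext A
    by_cases hA : ∃ t ∈ A, E t
    · have : ¬ ∀ t ∈ A, ¬ E t := by push Not; exact hA
      simp [hA, this]
    · have : ∀ t ∈ A, ¬ E t := by push Not at hA; exact hA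
      rw [if_neg hA, if_pos this, sub_self]
  rw [h, iterDelta_const_sub _ _ hL, neg_nonpos]
  unfold iterDelta
  have h2 : ∀ I ∈ L.powerset, (-1 : ℝ) ^ I.card * (if ∀ t ∈ K ∪ I, ¬ E t then 1 else 0) =
      (if ∀ t ∈ K, ¬ E t then 1 else 0) * ∏ t ∈ I, (if E t then 0 else (-1 : ℝ)) := by
    intro I _
    have h3 : ∏ t ∈ I, (if E t then 0 else (-1 : ℝ)) =
        (-1) ^ I.card * ∏ t ∈ I, if ¬ E t then 1 else 0 := by
      rw [← Finset.prod_const, ← Finset.prod_mul_distrib]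
      refine Finset.prod_congr rfl fun t _ => ?_
      by_cases ht : E t <;> simp [ht]
    rw [h3, Finset.prod_boole]
    have h4 : (∀ t ∈ K ∪ I, ¬ E t) ↔ (∀ t ∈ K, ¬ E t) ∧ ∀ t ∈ I, ¬ E t := by
      simp only [Finset.mem_union, or_imp, forall_and]
    by_cases hK : ∀ t ∈ K, ¬ E t
    · simp only [h4, eq_true hK, true_and, if_true, one_mul]
    · rw [if_neg hK, if_neg fun h => hK (h4.1 h).1, mul_zero, zero_mul]
  rw [Finset.sum_congr rfl h2, ← Finset.mul_sum, ← Finset.prod_one_add]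
  refine mul_nonneg (by split_ifs <;> norm_num) (Finset.prod_nonneg fun t _ => ?_)
  split_ifs <;> norm_num

/-- Capacity functionals are completely alternating. -/
lemma iterDelta_measure_nonpos {Ω : Type*} [MeasurableSpace Ω] (μ : Measure Ω) [IsFiniteMeasure μ]
    {E : T → Set Ω} (hE : ∀ t, MeasurableSet (E t)) {L : Finset T} (hL : L.Nonempty)
    (K : Finset T) : iterDelta (fun A => μ.real {ω | ∃ t ∈ A, ω ∈ E t}) L K ≤ 0 := by
  have hm : ∀ A : Finset T, MeasurableSet {ω | ∃ t ∈ A, ω ∈ E t} := fun A => by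
    have : {ω | ∃ t ∈ A, ω ∈ E t} = ⋃ t ∈ A, E t := by ext; simp
    rw [this]
    exact A.measurableSet_biUnion fun t _ => hE t
  have hi : ∀ A : Finset T, μ.real {ω | ∃ t ∈ A, ω ∈ E t} =
      ∫ ω, (if ∃ t ∈ A, ω ∈ E t then 1 else 0) ∂μ := fun A => by
    rw [← integral_indicator_one (hm A)]
    simp only [Set.indicator_apply, Set.mem_ofPred_eq, Pi.one_apply]
  have hint : ∀ A : Finset T,
      Integrable (fun ω => if ∃ t ∈ A, ω ∈ E t then (1 : ℝ) else 0) μ := fun A => by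
    have := (integrable_const (μ := μ) (1 : ℝ)).indicator (hm A)
    refine this.congr (ae_of_all _ fun ω => ?_)
    simp only [Set.indicator_apply, Set.mem_ofPred_eq]
  have : iterDelta (fun A => μ.real {ω | ∃ t ∈ A, ω ∈ E t}) L K =
      ∫ ω, iterDelta (fun A => if ∃ t ∈ A, ω ∈ E t then 1 else 0) L K ∂μ := by
    unfold iterDelta
    rw [integral_finsetSum _ fun I _ => (hint _).const_mul _]
    refine Finset.sum_congr rfl fun I _ => ?_
    simp only [integral_const_mul, hi]
  rw [this]
  exact integral_nonpos fun ω => iterDelta_hit_nonpos (fun t => ω ∈ E t) hL K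

/-- Cardinality is a finite sum of hit indicators, one for each point. -/
lemma isCompletelyAlternating_card : IsCompletelyAlternating fun A : Finset T => (A.card : ℝ) where
  empty := by simp
  singleton := by simp
  iterDelta_nonpos L K hL _ := by
    have h : ∀ I ∈ L.powerset, (-1 : ℝ) ^ I.card * ((K ∪ I).card : ℝ) =
        ∑ u ∈ K ∪ L, (-1 : ℝ) ^ I.card * (if ∃ t ∈ K ∪ I, t = u then 1 else 0) := fun I hI => by
      rw [← Finset.mul_sum]
      congr 1
      have hsub : K ∪ I ⊆ K ∪ L := Finset.union_subset_union_right (Finset.mem_powerset.1 hI)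
      rw [Finset.sum_boole]
      congr 2
      ext u
      simp only [exists_eq_right, Finset.mem_filter]
      exact ⟨fun h => ⟨hsub h, h⟩, fun h => h.2⟩
    unfold iterDelta
    rw [Finset.sum_congr rfl h, Finset.sum_comm]
    exact Finset.sum_nonpos fun u _ => iterDelta_hit_nonpos (fun t => t = u) hL K

lemma isClosed_isCompletelyAlternating :
    IsClosed {θ : Finset T → ℝ | IsCompletelyAlternating θ} := by
  have : {θ : Finset T → ℝ | IsCompletelyAlternating θ} =
      {θ | θ ∅ = 0} ∩ (⋂ t, {θ | θ {t} = 1}) ∩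
        ⋂ (L : Finset T) (K : Finset T) (_ : L.Nonempty) (_ : Disjoint L K),
          {θ | iterDelta θ L K ≤ 0} := by
    ext θ
    simp only [Set.mem_ofPred_eq, Set.mem_inter_iff, Set.mem_iInter]
    exact ⟨fun h => ⟨⟨h.1, h.2⟩, h.3⟩, fun h => ⟨h.1.1, h.1.2, h.2⟩⟩
  rw [this]
  refine ((isClosed_eq (continuous_apply _) continuous_const).inter
    (isClosed_iInter fun t => isClosed_eq (continuous_apply _) continuous_const)).inter
    (isClosed_iInter fun L => isClosed_iInter fun K => isClosed_iInter fun _ =>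
      isClosed_iInter fun _ => isClosed_le ?_ continuous_const)
  unfold iterDelta
  fun_prop

lemma isCompact_isCompletelyAlternating :
    IsCompact {θ : Finset T → ℝ | IsCompletelyAlternating θ} :=
  (isCompact_univ_pi fun A : Finset T => isCompact_Icc (a := (0 : ℝ)) (b := A.card)).of_isClosed_subset
    isClosed_isCompletelyAlternating fun _ h A _ => ⟨h.nonneg A, h.le_card A⟩

lemma continuous_psi : Continuous (psi T) := by
  unfold psi
  fun_prop

lemma isClosed_psi_image : IsClosed (psi T '' {θ | IsCompletelyAlternating θ}) :=
  (isCompact_isCompletelyAlternating.image continuous_psi).isClosed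

end Alternating

/-! ### From Fréchet margins to extremal coefficients and tail correlations. -/

section Frechet

open scoped Classical

/-- This is the derivative of `1 - exp (-c u)` at `u = 0`, read along `u = 1 / τ`. -/
lemma tendsto_mul_one_sub_exp (c : ℝ) :
    Tendsto (fun τ : ℝ => τ * (1 - Real.exp (-c / τ))) atTop (𝓝 c) := by
  have hd : HasDerivAt (fun u : ℝ => 1 - Real.exp (-c * u)) c 0 := by
    have h1 : HasDerivAt (fun u : ℝ => -c * u) (-c) 0 := by
      simpa using (hasDerivAt_id (0 : ℝ)).const_mul (-c)
    simpa using h1.exp.const_sub 1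
  have hs := (hasDerivAt_iff_tendsto_slope_zero.1 hd).comp
    (tendsto_inv_atTop_nhdsGT_zero.mono_right
      (nhdsWithin_mono (0 : ℝ) fun _ h => ne_of_gt (Set.mem_Ioi.1 h)))
  refine hs.congr fun τ => ?_
  simp [div_eq_mul_inv]

lemma measureReal_cond {Ω : Type*} [MeasurableSpace Ω] {P : Measure Ω} {s : Set Ω}
    (hs : MeasurableSet s) (t : Set Ω) : (P[|s]).real t = P.real (s ∩ t) / P.real s := by
  rw [measureReal_def, cond_apply hs, ENNReal.toReal_mul, ENNReal.toReal_inv, ← measureReal_def,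
    ← measureReal_def, div_eq_inv_mul]

lemma belowEndpoint_top : belowEndpoint ⊤ = atTop := by
  have : Set.Iio (⊤ : EReal) = {⊤}ᶜ := by
    ext x
    simp [lt_top_iff_ne_top]
  unfold belowEndpoint
  rw [this, EReal.nhdsWithin_top]
  exact comap_map EReal.coe_injective

variable {T Ω : Type u} [MeasurableSpace Ω] {P : Measure Ω} {X : T → Ω → ℝ}

lemma measureReal_gt_eq (hX : IsProcess P X) (t : T) (τ : ℝ) :
    P.real {ω | τ < X t ω} = 1 - P.real {ω | X t ω ≤ τ} := by
  have := hX.prob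
  have h : {ω | τ < X t ω} = {ω | X t ω ≤ τ}ᶜ := by ext; simp
  rw [h, probReal_compl_eq_one_sub (measurableSet_le (hX.meas t) measurable_const)]

lemma measureReal_exists_gt_eq (hX : IsProcess P X) (A : Finset T) (τ : ℝ) :
    P.real {ω | ∃ t ∈ A, τ < X t ω} = 1 - P.real {ω | ∀ t ∈ A, X t ω ≤ τ} := by
  have := hX.prob
  have h : {ω | ∃ t ∈ A, τ < X t ω} = {ω | ∀ t ∈ A, X t ω ≤ τ}ᶜ := by ext; simp
  have hm : MeasurableSet {ω | ∀ t ∈ A, X t ω ≤ τ} := by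
    have : {ω | ∀ t ∈ A, X t ω ≤ τ} = ⋂ t ∈ A, {ω | X t ω ≤ τ} := by ext; simp
    rw [this]
    exact A.measurableSet_biInter fun t _ => measurableSet_le (hX.meas t) measurable_const
  rw [h, probReal_compl_eq_one_sub hm]

lemma measureReal_le_nonpos (hX : IsProcess P X)
    (hF : ∀ t, ∀ x : ℝ, 0 < x → P.real {ω | X t ω ≤ x} = Real.exp (-1 / x)) (t : T) {x : ℝ}
    (hx : x ≤ 0) : P.real {ω | X t ω ≤ x} = 0 := by
  have := hX.prob
  refine le_antisymm ?_ measureReal_nonneg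
  have hlim : Tendsto (fun y : ℝ => Real.exp (-1 / y⁻¹)) atTop (𝓝 0) := by
    have : (fun y : ℝ => Real.exp (-1 / y⁻¹)) = fun y => Real.exp (-y) := by
      funext y
      rw [div_inv_eq_mul, neg_one_mul]
    rw [this]
    exact Real.tendsto_exp_neg_atTop_nhds_zero
  refine ge_of_tendsto hlim ((eventually_gt_atTop 0).mono fun y hy => ?_)
  have hy' := inv_pos.2 hy
  rw [← hF t _ hy']
  exact measureReal_mono fun ω hω => le_trans (show X t ω ≤ x from hω) (hx.trans hy'.le)

lemma identicalMargins_of_frechet (hX : IsProcess P X)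
    (hF : ∀ t, ∀ x : ℝ, 0 < x → P.real {ω | X t ω ≤ x} = Real.exp (-1 / x)) :
    IdenticalMargins P X := fun s t => by
  have := hX.prob
  refine ⟨(hX.meas s).aemeasurable, (hX.meas t).aemeasurable, ?_⟩
  have := Measure.isProbabilityMeasure_map (μ := P) (hX.meas s).aemeasurable
  refine Measure.ext_of_Iic _ _ fun x => ?_
  rw [Measure.map_apply (hX.meas s) measurableSet_Iic,
    Measure.map_apply (hX.meas t) measurableSet_Iic, ← measureReal_eq_measureReal_iff]
  change P.real {ω | X s ω ≤ x} = P.real {ω | X t ω ≤ x}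
  rcases le_or_gt x 0 with hx | hx
  · rw [measureReal_le_nonpos hX hF s hx, measureReal_le_nonpos hX hF t hx]
  · rw [hF s x hx, hF t x hx]

lemma upperEndpoint_of_frechet (hX : IsProcess P X)
    (hF : ∀ t, ∀ x : ℝ, 0 < x → P.real {ω | X t ω ≤ x} = Real.exp (-1 / x)) (t : T) :
    upperEndpoint P (X t) = ⊤ := by
  have := hX.prob
  by_contra hne
  obtain ⟨τ, hτ, -⟩ := EReal.lt_iff_exists_real_btwn.1 (lt_top_iff_ne_top.2 hne)
  have hpos : (0 : ℝ) < max τ 1 := lt_max_of_lt_right one_pos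
  have hae : ∀ᵐ ω ∂P, X t ω ≤ max τ 1 := by
    filter_upwards [ae_le_essSup (μ := P) (f := fun ω => (X t ω : EReal))] with ω hω
    exact le_max_of_le_left (EReal.coe_le_coe_iff.1 (hω.trans hτ.le))
  have h1 : P.real {ω | X t ω ≤ max τ 1} = 1 := by
    rw [measureReal_def, prob_compl_eq_zero_iff
      (measurableSet_le (hX.meas t) measurable_const) |>.1 hae, ENNReal.toReal_one]
  rw [hF t _ hpos, Real.exp_eq_one_iff, div_eq_zero_iff] at h1
  rcases h1 with h1 | h1
  · norm_num at h1
  · exact hpos.ne' h1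

lemma tendsto_mul_measureReal_gt (hX : IsProcess P X)
    (hF : ∀ t, ∀ x : ℝ, 0 < x → P.real {ω | X t ω ≤ x} = Real.exp (-1 / x)) (t : T) :
    Tendsto (fun τ : ℝ => τ * P.real {ω | τ < X t ω}) atTop (𝓝 1) := by
  refine (tendsto_mul_one_sub_exp 1).congr' ((eventually_gt_atTop 0).mono fun τ hτ => ?_)
  simp only
  rw [measureReal_gt_eq hX, hF t τ hτ]

lemma tendsto_measureReal_exists_gt (hX : IsProcess P X)
    (hF : ∀ t, ∀ x : ℝ, 0 < x → P.real {ω | X t ω ≤ x} = Real.exp (-1 / x)) (A : Finset T) :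
    Tendsto (fun τ : ℝ => P.real {ω | ∃ t ∈ A, τ < X t ω}) atTop (𝓝 0) := by
  have := hX.prob
  have h1 : ∀ t, Tendsto (fun τ : ℝ => P.real {ω | τ < X t ω}) atTop (𝓝 0) := fun t => by
    have := tendsto_inv_atTop_zero.mul (tendsto_mul_measureReal_gt hX hF t)
    rw [zero_mul] at this
    refine this.congr' ((eventually_gt_atTop 0).mono fun τ hτ => ?_)
    exact inv_mul_cancel_left₀ hτ.ne' _
  have h2 : Tendsto (fun τ : ℝ => ∑ t ∈ A, P.real {ω | τ < X t ω}) atTop (𝓝 0) := by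
    simpa using tendsto_finsetSum A fun t _ => h1 t
  refine squeeze_zero (fun _ => measureReal_nonneg) (fun τ => ?_) h2
  have : {ω | ∃ t ∈ A, τ < X t ω} = ⋃ t ∈ A, {ω | τ < X t ω} := by ext; simp
  rw [this]
  exact measureReal_biUnion_finset_le A _

variable {θ : Finset T → ℝ}

lemma tendsto_mul_measureReal_exists_gt (hX : IsProcess P X)
    (hF : ∀ t, ∀ x : ℝ, 0 < x → P.real {ω | X t ω ≤ x} = Real.exp (-1 / x)) (hθ : IsECF P X θ)
    (A : Finset T) :
    Tendsto (fun τ : ℝ => τ * P.real {ω | ∃ t ∈ A, τ < X t ω}) atTop (𝓝 (θ A)) := by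
  rcases A.eq_empty_or_nonempty with rfl | hA
  · simp [hθ.empty]
  refine (tendsto_mul_one_sub_exp (θ A)).congr' ?_
  -- `Real.log 0 = 0` would make the defining formula of `θ` uninformative; for large `τ` the
  -- probability is positive, so the logarithm can be inverted.
  filter_upwards [eventually_gt_atTop 0,
    (tendsto_measureReal_exists_gt hX hF A).eventually (gt_mem_nhds one_pos)] with τ hτ hlt
  rw [measureReal_exists_gt_eq hX] at hlt ⊢
  have hG : 0 < P.real {ω | ∀ t ∈ A, X t ω ≤ τ} := by linarith
  have : -θ A / τ = Real.log (P.real {ω | ∀ t ∈ A, X t ω ≤ τ}) := by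
    rw [hθ.eq A hA τ hτ]
    field_simp
  rw [this, Real.exp_log hG]

lemma isCompletelyAlternating_of_ecf (hX : IsProcess P X)
    (hF : ∀ t, ∀ x : ℝ, 0 < x → P.real {ω | X t ω ≤ x} = Real.exp (-1 / x)) (hθ : IsECF P X θ) :
    IsCompletelyAlternating θ where
  empty := hθ.empty
  singleton t := by
    have h := hθ.eq {t} (Finset.singleton_nonempty t) 1 one_pos
    simp only [Finset.mem_singleton, forall_eq] at h
    rw [h, hF t 1 one_pos, Real.log_exp]
    norm_num
  iterDelta_nonpos L K hL _ := by
    have := hX.prob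
    have hlim : Tendsto (fun τ : ℝ =>
        iterDelta (fun A => τ * P.real {ω | ∃ t ∈ A, τ < X t ω}) L K) atTop
        (𝓝 (iterDelta θ L K)) := by
      unfold iterDelta
      exact tendsto_finsetSum _ fun I _ =>
        (tendsto_mul_measureReal_exists_gt hX hF hθ (K ∪ I)).const_mul _
    refine le_of_tendsto hlim ((eventually_gt_atTop 0).mono fun τ hτ => ?_)
    have hscale : (fun A : Finset T => τ * P.real {ω | ∃ t ∈ A, τ < X t ω}) =
        fun A => P.real {ω | ∃ t ∈ A, ω ∈ {ω | τ < X t ω}} / τ⁻¹ := by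
      funext A
      rw [div_inv_eq_mul, mul_comm]
      rfl
    rw [hscale, iterDelta_div]
    exact div_nonpos_of_nonpos_of_nonneg (iterDelta_measure_nonpos P
      (fun t => measurableSet_lt measurable_const (hX.meas t)) hL K) (inv_nonneg.2 hτ.le)

/-- Inclusion–exclusion, with numerator and denominator multiplied by `τ`: the quotient tends to `(1
+ 1 - θ {s, t}) / 1`. -/
lemma hasTCF_of_ecf (hX : IsProcess P X)
    (hF : ∀ t, ∀ x : ℝ, 0 < x → P.real {ω | X t ω ≤ x} = Real.exp (-1 / x)) (hθ : IsECF P X θ) :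
    HasTCF P X (psi T θ) where
  margins := identicalMargins_of_frechet hX hF
  tendsto s t := by
    have := hX.prob
    rw [upperEndpoint_of_frechet hX hF, belowEndpoint_top]
    have hs := tendsto_mul_measureReal_gt hX hF s
    have ht := tendsto_mul_measureReal_gt hX hF t
    have hst := tendsto_mul_measureReal_exists_gt hX hF hθ {s, t}
    have hlim := ((hs.add ht).sub hst).div ht one_ne_zero
    have hval : ((1 : ℝ) + 1 - θ {s, t}) / 1 = psi T θ (s, t) := by
      simp only [psi]
      norm_num
    rw [hval] at hlim
    refine hlim.congr' ((eventually_gt_atTop 0).mono fun τ hτ => ?_)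
    have hms : ∀ t, MeasurableSet {ω | τ < X t ω} := fun t =>
      measurableSet_lt measurable_const (hX.meas t)
    have hU : {ω | ∃ r ∈ ({s, t} : Finset T), τ < X r ω} =
        {ω | τ < X t ω} ∪ {ω | τ < X s ω} := by
      ext ω
      simp [or_comm]
    have h := measureReal_union_add_inter (μ := P) (s := {ω | τ < X t ω}) (hms s)
    rw [Pi.div_apply]
    beta_reduce
    rw [measureReal_cond (hms t), hU]
    have hnum : τ * P.real {ω | τ < X s ω} + τ * P.real {ω | τ < X t ω} -
        τ * P.real ({ω | τ < X t ω} ∪ {ω | τ < X s ω}) =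
        τ * P.real ({ω | τ < X t ω} ∩ {ω | τ < X s ω}) := by
      rw [← mul_add, ← mul_sub]
      congr 1
      linarith
    rw [hnum, mul_div_mul_left _ _ hτ.ne']

end Frechet

/-! ### The unit Fréchet law. -/

section FrechetLaw

/-- The law of the reciprocal of a standard exponential random variable. -/
noncomputable def frechetLaw : Measure ℝ := (expMeasure 1).map fun e => e⁻¹

instance : IsProbabilityMeasure frechetLaw :=
  have := isProbabilityMeasure_expMeasure one_pos
  Measure.isProbabilityMeasure_map measurable_inv.aemeasurable

lemma expMeasure_real_Iic {x : ℝ} (hx : 0 ≤ x) :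
    (expMeasure 1).real (Set.Iic x) = 1 - Real.exp (-x) := by
  have := isProbabilityMeasure_expMeasure one_pos
  rw [← cdf_eq_real, cdf_expMeasure_eq one_pos, if_pos hx, one_mul]

lemma frechetLaw_real_mul_le_one {c : ℝ} (hc : 0 ≤ c) :
    frechetLaw.real {u | c * u ≤ 1} = Real.exp (-c) := by
  have := isProbabilityMeasure_expMeasure one_pos
  rcases hc.eq_or_lt with rfl | hc'
  · simp
  have hm : MeasurableSet {u : ℝ | c * u ≤ 1} :=
    measurableSet_le (measurable_const_mul c) measurable_const
  -- Two null sets are discarded: the point `c`, where `≤` and `<` differ, and the half-line `e ≤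
  -- 0`, where multiplying by `e` does not preserve the inequality.
  have hne : expMeasure 1 {c} = 0 :=
    withDensity_absolutelyContinuous volume (gammaPDF 1 1) Real.volume_singleton
  have h0 : (expMeasure 1) (Set.Iic 0) = 0 := by
    have := expMeasure_real_Iic le_rfl
    rw [neg_zero, Real.exp_zero, sub_self] at this
    exact (measureReal_eq_zero_iff).1 this
  have hcongr : (expMeasure 1).real ((fun e : ℝ => e⁻¹) ⁻¹' {u | c * u ≤ 1}) =
      (expMeasure 1).real (Set.Ioi c) := by
    refine measureReal_congr ?_
    filter_upwards [compl_mem_ae_iff.2 hne, compl_mem_ae_iff.2 h0] with e he1 he2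
    have he : 0 < e := by simpa using he2
    have hec : e ≠ c := he1
    refine propext ?_
    change c * e⁻¹ ≤ 1 ↔ c < e
    rw [mul_inv_le_iff₀ he, one_mul]
    exact ⟨fun h => lt_of_le_of_ne h hec.symm, le_of_lt⟩
  rw [frechetLaw, map_measureReal_apply measurable_inv hm, hcongr, ← Set.compl_Iic,
    probReal_compl_eq_one_sub measurableSet_Iic, expMeasure_real_Iic hc]
  ring

end FrechetLaw

/-! ### Uniqueness of laws of positive vectors. -/

section PositiveOrthants

variable {ι : Type*} [Fintype ι]

/-- Two laws of positive random vectors agree if their distribution functions do. -/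
lemma ext_of_pos_orthants {μ ν : Measure (ι → ℝ)} [IsProbabilityMeasure μ]
    [IsProbabilityMeasure ν] (hμ : ∀ t, μ.real {x | x t ≤ 0} = 0)
    (hν : ∀ t, ν.real {x | x t ≤ 0} = 0)
    (h : ∀ a : ι → ℝ, (∀ t, 0 < a t) → μ.real {x | ∀ t, x t ≤ a t} = ν.real {x | ∀ t, x t ≤ a t}) :
    μ = ν := by
  have hspan : IsCountablySpanning (Set.range (Set.Iic : ℝ → Set ℝ)) := by
    refine ⟨fun n : ℕ => Set.Iic (n : ℝ), fun n => ⟨n, rfl⟩, ?_⟩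
    exact Set.eq_univ_of_forall fun x =>
      let ⟨n, hn⟩ := exists_nat_ge x
      Set.mem_iUnion.2 ⟨n, hn⟩
  have hgen : MeasurableSpace.generateFrom (Set.range (Set.Iic : ℝ → Set ℝ)) =
      (inferInstance : MeasurableSpace ℝ) := by
    rw [← borel_eq_generateFrom_Iic]
    exact (BorelSpace.measurable_eq (α := ℝ)).symm
  refine ext_of_generate_finite _ (generateFrom_eq_pi (fun _ => hgen) fun _ => hspan).symm
    (IsPiSystem.pi fun _ => isPiSystem_Iic) ?_ (by simp)
  rintro _ ⟨s, hs, rfl⟩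
  choose a ha using fun t => hs t (Set.mem_univ t)
  have hset : Set.univ.pi s = {x | ∀ t, x t ≤ a t} := by
    ext x
    simp [← ha]
  rw [hset, ← measureReal_eq_measureReal_iff]
  by_cases hpos : ∀ t, 0 < a t
  · exact h a hpos
  · push Not at hpos
    obtain ⟨t, ht⟩ := hpos
    have hsub : {x : ι → ℝ | ∀ t, x t ≤ a t} ⊆ {x | x t ≤ 0} := fun x hx => (hx t).trans ht
    rw [measureReal_mono_null hsub (hμ t), measureReal_mono_null hsub (hν t)]

end PositiveOrthants

/-! ### The exponent function of a Tawn–Molchanov law. -/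

section Exponent

open scoped Classical

variable {T : Type u} {θ : Finset T → ℝ}

/-- The exponent function `∑_L w_A(L) max_{t ∈ L} y_t` of a Tawn–Molchanov law. -/
noncomputable def exponent (θ : Finset T → ℝ) (A : Finset T) (y : T → ℝ≥0) : ℝ :=
  ∑ L ∈ A.powerset, weight θ A L * (L.sup y : ℝ≥0)

/-- The `y t` are reciprocal levels, so `y t = 0` imposes no constraint. Passing to a marginal thus
amounts to inserting zeros, which reduces `L.sup y` to `(L ∩ B).sup y`. -/
lemma exponent_of_subset (θ : Finset T → ℝ) {A B : Finset T} (hBA : B ⊆ A) {y : T → ℝ≥0}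
    (hy : ∀ t ∉ B, y t = 0) : exponent θ A y = exponent θ B y := by
  unfold exponent
  rw [← sum_weight_inter θ (fun L => ((L.sup y : ℝ≥0) : ℝ)) hBA]
  refine Finset.sum_congr rfl fun L _ => ?_
  congr 2
  refine le_antisymm (Finset.sup_le fun t ht => ?_) (Finset.sup_mono Finset.inter_subset_left)
  by_cases htB : t ∈ B
  · exact Finset.le_sup (f := y) (Finset.mem_inter.2 ⟨ht, htB⟩)
  · rw [hy t htB]
    exact zero_le

lemma exponent_const (hθ : θ ∅ = 0) (A : Finset T) (c : ℝ≥0) :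
    exponent θ A (fun _ => c) = θ A * c := by
  unfold exponent
  rw [← sum_weight_hit hθ (Finset.Subset.refl A), Finset.sum_mul]
  refine Finset.sum_congr rfl fun L hL => ?_
  rw [Finset.inter_eq_left.2 (Finset.mem_powerset.1 hL)]
  rcases L.eq_empty_or_nonempty with rfl | hne
  · simp
  · rw [Finset.sup_const hne, if_pos hne, mul_one]

lemma exponent_mul (θ : Finset T → ℝ) (A : Finset T) (c : ℝ≥0) (y : T → ℝ≥0) :
    exponent θ A (fun t => c * y t) = c * exponent θ A y := by
  unfold exponent
  rw [Finset.mul_sum]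
  refine Finset.sum_congr rfl fun L _ => ?_
  rw [← NNReal.mul_finset_sup, NNReal.coe_mul]
  ring

lemma exponent_congr (θ : Finset T → ℝ) {A : Finset T} {y z : T → ℝ≥0}
    (h : ∀ t ∈ A, y t = z t) : exponent θ A y = exponent θ A z := by
  unfold exponent
  refine Finset.sum_congr rfl fun L hL => ?_
  rw [Finset.sup_congr rfl fun t ht => h t (Finset.mem_powerset.1 hL ht)]

end Exponent

/-! ### Finite-dimensional Tawn–Molchanov laws and their projective limit. -/

section FiniteLaw

open scoped Classical

variable {T : Type u} {θ : Finset T → ℝ}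

/-- The spectral vector `X_t = max_{L ∋ t} w_A(L) z_L`. -/
noncomputable def spectralMax (θ : Finset T → ℝ) (A : Finset T) (z : A.powerset → ℝ) (t : A) : ℝ :=
  ⨆ L : A.powerset, if (t : T) ∈ (L : Finset T) then weight θ A L * z L else 0

lemma measurable_spectralMax (θ : Finset T → ℝ) (A : Finset T) :
    Measurable (spectralMax θ A) := by
  refine measurable_pi_lambda _ fun t => Measurable.iSup fun L => ?_
  split_ifs
  · exact (measurable_pi_apply L).const_mul _
  · exact measurable_const

/-- The finite-dimensional Tawn–Molchanov law on `A`. -/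
noncomputable def tmLaw (θ : Finset T → ℝ) (A : Finset T) : Measure (A → ℝ) :=
  (Measure.pi fun _ : A.powerset => frechetLaw).map (spectralMax θ A)

instance (A : Finset T) : IsProbabilityMeasure (tmLaw θ A) :=
  Measure.isProbabilityMeasure_map (measurable_spectralMax θ A).aemeasurable

lemma measurableSet_forall_mul_le_one (A : Finset T) (y : T → ℝ≥0) :
    MeasurableSet {x : A → ℝ | ∀ t : A, x t * y t ≤ 1} := by
  have : {x : A → ℝ | ∀ t : A, x t * y t ≤ 1} = ⋂ t : A, {x : A → ℝ | x t * y t ≤ 1} := by ext; simp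
  rw [this]
  exact MeasurableSet.iInter fun t =>
    measurableSet_le ((measurable_pi_apply t).mul_const _) measurable_const

/-- Exchanging the two maxima turns the event into one constraint `w_A(L) (max_L y) z_L ≤ 1` for
each `L`; independence gives a product of Fréchet probabilities. The set `∅` contains no `t`, so its
negative weight never enters. -/
lemma tmLaw_real_le (hθ : IsCompletelyAlternating θ) (A : Finset T) (y : T → ℝ≥0) :
    (tmLaw θ A).real {x | ∀ t : A, x t * y t ≤ 1} = Real.exp (-exponent θ A y) := by
  have hm := measurableSet_forall_mul_le_one A y
  have hpre : spectralMax θ A ⁻¹' {x | ∀ t : A, x t * y t ≤ 1} =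
      Set.univ.pi fun L : A.powerset =>
        {u | (weight θ A L * ((L : Finset T).sup y : ℝ≥0)) * u ≤ 1} := by
    ext z
    simp only [Set.mem_preimage, Set.mem_ofPred_eq, Set.mem_pi, Set.mem_univ, true_imp_iff,
      spectralMax]
    have h1 : ∀ t : A, (⨆ L : A.powerset, if (t : T) ∈ (L : Finset T) then weight θ A L * z L
        else 0) * (y t : ℝ) ≤ 1 ↔
          ∀ L : A.powerset, (t : T) ∈ (L : Finset T) → weight θ A L * z L * y t ≤ 1 := fun t => by
      have : Nonempty A.powerset := ⟨⟨∅, Finset.empty_mem_powerset A⟩⟩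
      rw [Real.iSup_mul_of_nonneg (NNReal.coe_nonneg (y t)), ciSup_le_iff (Set.finite_range _).bddAbove]
      refine forall_congr' fun L => ?_
      split_ifs with h
      · simp [h]
      · simp [h]
    rw [forall_congr' h1, forall_comm]
    refine forall_congr' fun L => ?_
    have hLA := Finset.mem_powerset.1 L.2
    constructor
    · intro h
      rcases (L : Finset T).eq_empty_or_nonempty with he | hne
      · simp [he]
      · obtain ⟨t, ht, hty⟩ := Finset.exists_mem_eq_sup _ hne y
        rw [hty, mul_right_comm]
        exact h ⟨t, hLA ht⟩ ht
    · intro h t ht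
      rw [mul_right_comm] at h
      -- `z L` is positive only almost surely, while the set identity is pointwise; negative
      -- products satisfy the bound trivially.
      rcases le_or_gt 0 (weight θ A L * z L) with h0 | h0
      · exact (mul_le_mul_of_nonneg_left (NNReal.coe_le_coe.2 (Finset.le_sup (f := y) ht)) h0).trans h
      · exact (mul_nonpos_of_nonpos_of_nonneg h0.le (y t).2).trans zero_le_one
  rw [tmLaw, map_measureReal_apply (measurable_spectralMax θ A) hm, hpre, measureReal_def,
    Measure.pi_pi, ENNReal.toReal_prod, exponent, ← Finset.sum_neg_distrib, Real.exp_sum,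
    ← Finset.prod_coe_sort A.powerset]
  refine Finset.prod_congr rfl fun L _ => ?_
  rw [← measureReal_def, frechetLaw_real_mul_le_one]
  rcases (L : Finset T).eq_empty_or_nonempty with he | hne
  · simp [he]
  · exact mul_nonneg (weight_nonneg hθ A hne) (NNReal.coe_nonneg _)

lemma tmLaw_real_le_of_subset (hθ : IsCompletelyAlternating θ) {A B : Finset T} (hBA : B ⊆ A)
    (y : T → ℝ≥0) :
    (tmLaw θ A).real {x | ∀ t : A, (t : T) ∈ B → x t * y t ≤ 1} =
      Real.exp (-exponent θ B y) := by
  have h := tmLaw_real_le hθ A fun t => if t ∈ B then y t else 0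
  rw [exponent_of_subset θ hBA fun t ht => if_neg ht,
    exponent_congr θ fun t ht => if_pos (c := t ∈ B) ht] at h
  rw [← h]
  congr 1
  ext x
  refine forall_congr' fun t => ?_
  by_cases ht : (t : T) ∈ B <;> simp [ht]

lemma tmLaw_real_nonpos (hθ : IsCompletelyAlternating θ) {A : Finset T} (t : A) :
    (tmLaw θ A).real {x | x t ≤ 0} = 0 := by
  refine le_antisymm ?_ measureReal_nonneg
  have hlim : Tendsto (fun n : ℕ => Real.exp (-(n : ℝ))) atTop (𝓝 0) :=
    Real.tendsto_exp_neg_atTop_nhds_zero.comp tendsto_natCast_atTop_atTop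
  refine ge_of_tendsto' hlim fun n => ?_
  have h := tmLaw_real_le_of_subset hθ (Finset.singleton_subset_iff.2 t.2) fun _ => (n : ℝ≥0)
  rw [exponent_const hθ.empty, hθ.singleton, one_mul, NNReal.coe_natCast] at h
  rw [← h]
  refine measureReal_mono fun x hx s hs => ?_
  have hst : s = t := Subtype.ext (Finset.mem_singleton.1 hs)
  rw [hst]
  exact (mul_nonpos_of_nonpos_of_nonneg hx (Nat.cast_nonneg n)).trans zero_le_one

/-- Both laws charge only positive vectors, so comparing distribution functions at positive levels
suffices; there both equal `exp (-exponent θ J y)`. -/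
lemma isProjectiveMeasureFamily_tmLaw (hθ : IsCompletelyAlternating θ) :
    IsProjectiveMeasureFamily (α := fun _ => ℝ) (tmLaw θ) := by
  intro I J hJI
  have hr := Finset.measurable_restrict₂ (X := fun _ : T => ℝ) hJI
  have hmeas : ∀ (t : J) (a : ℝ), MeasurableSet {x : J → ℝ | x t ≤ a} := fun t a =>
    measurableSet_le (measurable_pi_apply t) measurable_const
  have := Measure.isProbabilityMeasure_map (μ := tmLaw θ I) hr.aemeasurable
  refine ext_of_pos_orthants (fun t => tmLaw_real_nonpos hθ t) (fun t => ?_) fun a ha => ?_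
  · rw [map_measureReal_apply hr (hmeas t 0)]
    exact tmLaw_real_nonpos hθ (⟨t, hJI t.2⟩ : I)
  · have hm : MeasurableSet {x : J → ℝ | ∀ t, x t ≤ a t} := by
      have : {x : J → ℝ | ∀ t, x t ≤ a t} = ⋂ t, {x | x t ≤ a t} := by ext; simp
      rw [this]
      exact MeasurableSet.iInter fun t => hmeas t (a t)
    let y : T → ℝ≥0 := fun t => if h : t ∈ J then (a ⟨t, h⟩)⁻¹.toNNReal else 0
    have hy : ∀ t (h : t ∈ J) (x : ℝ), x * y t ≤ 1 ↔ x ≤ a ⟨t, h⟩ := fun t h x => by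
      simp only [y, dif_pos h]
      rw [Real.coe_toNNReal _ (inv_nonneg.2 (ha _).le), mul_inv_le_iff₀ (ha _), one_mul]
    have h1 := tmLaw_real_le hθ J y
    have h2 := tmLaw_real_le_of_subset hθ hJI y
    rw [map_measureReal_apply hr hm]
    have e1 : {x : J → ℝ | ∀ t, x t ≤ a t} = {x : J → ℝ | ∀ t : J, x t * y t ≤ 1} := by
      ext x
      exact forall_congr' fun t => (hy t t.2 (x t)).symm
    have e2 : Finset.restrict₂ (π := fun _ => ℝ) hJI ⁻¹' {x : J → ℝ | ∀ t, x t ≤ a t} =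
        {x : I → ℝ | ∀ t : I, (t : T) ∈ J → x t * y t ≤ 1} := by
      ext x
      constructor
      · intro h t ht
        exact (hy t ht _).2 (h ⟨t, ht⟩)
      · intro h t
        exact (hy t t.2 _).1 (h ⟨t, hJI t.2⟩ t.2)
    rw [e2, h2, e1, h1]

/-- Existence of the Tawn–Molchanov process with a given completely alternating function. -/
theorem exists_tm_law (hθ : IsCompletelyAlternating θ) :
    ∃ P : Measure (T → ℝ), IsProcess P (fun t x => x t) ∧ ∀ (A : Finset T) (y : T → ℝ≥0),
      P.real {x | ∀ t ∈ A, x t * y t ≤ 1} = Real.exp (-exponent θ A y) := by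
  obtain ⟨P, hP⟩ := exists_isProjectiveLimit (isProjectiveMeasureFamily_tmLaw hθ)
  refine ⟨P, ⟨hP.isProbabilityMeasure, fun t => measurable_pi_apply t⟩, fun A y => ?_⟩
  rw [← tmLaw_real_le hθ A y, ← hP A, map_measureReal_apply (Finset.measurable_restrict A)]
  · congr 1
    ext x
    exact (Subtype.forall (p := (· ∈ A)) (q := fun t => x t * y t ≤ 1)).symm
  · exact measurableSet_forall_mul_le_one A y

end FiniteLaw

/-! ### Random sets with a prescribed bounded capacity functional. -/

section BinaryLaw

open scoped Classical

variable {T : Type u} {θ : Finset T → ℝ} {κ : ℝ}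

/-- The law of the indicator of the random subset `L` of `A` with probabilities
`w_A(L)`. -/
noncomputable def binLaw (φ : Finset T → ℝ) (A : Finset T) : Measure (A → ℝ) :=
  ∑ L ∈ A.powerset, ENNReal.ofReal (weight φ A L) •
    Measure.dirac fun t : A => if (t : T) ∈ L then 1 else 0

instance (φ : Finset T → ℝ) (A : Finset T) : IsFiniteMeasure (binLaw φ A) := by
  unfold binLaw
  refine ⟨?_⟩
  rw [Measure.finsetSum_apply]
  simp

/-- `ENNReal.ofReal` cuts negative weights to zero, so nonnegativity, for `L = ∅` too, is what makes
the formula exact. -/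
lemma binLaw_real {φ : Finset T → ℝ} {A : Finset T} (hφ : ∀ L ⊆ A, 0 ≤ weight φ A L)
    {S : Set (A → ℝ)} (hS : MeasurableSet S) :
    (binLaw φ A).real S = ∑ L ∈ A.powerset, weight φ A L *
      (if (fun t : A => if (t : T) ∈ L then (1 : ℝ) else 0) ∈ S then 1 else 0) := by
  rw [measureReal_def, binLaw, Measure.finsetSum_apply, ENNReal.toReal_sum]
  · refine Finset.sum_congr rfl fun L hL => ?_
    rw [Measure.smul_apply, Measure.dirac_apply' _ hS, smul_eq_mul, ENNReal.toReal_mul,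
      ENNReal.toReal_ofReal (hφ L (Finset.mem_powerset.1 hL)), Set.indicator_apply]
    split_ifs <;> simp
  · intro L _
    rw [Measure.smul_apply, smul_eq_mul]
    exact ENNReal.mul_ne_top ENNReal.ofReal_ne_top (measure_ne_top _ _)

lemma isProjectiveMeasureFamily_binLaw {φ : Finset T → ℝ}
    (hφ : ∀ A, ∀ L ⊆ A, 0 ≤ weight φ A L) :
    IsProjectiveMeasureFamily (α := fun _ => ℝ) (binLaw φ) := by
  intro I J hJI
  have hr := Finset.measurable_restrict₂ (X := fun _ : T => ℝ) hJI
  ext S hS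
  rw [← measureReal_eq_measureReal_iff, map_measureReal_apply hr hS, binLaw_real (hφ J) hS,
    binLaw_real (hφ I) (hr hS), ← sum_weight_inter φ (fun L =>
      if (fun t : J => if (t : T) ∈ L then (1 : ℝ) else 0) ∈ S then 1 else 0) hJI]
  refine Finset.sum_congr rfl fun L _ => ?_
  congr 1
  have : (fun t : J => if (t : T) ∈ L ∩ J then (1 : ℝ) else 0) =
      Finset.restrict₂ (π := fun _ => ℝ) hJI fun t : I => if (t : T) ∈ L then (1 : ℝ) else 0 := by
    funext t
    simp [Finset.restrict₂]
  rw [this]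
  rfl

/-- Bounded completely alternating functions are, up to a factor, capacity functionals of random
sets. -/
theorem exists_bin_law (hθ : IsCompletelyAlternating θ) (hκ : 0 < κ) (hb : ∀ A, θ A ≤ κ) :
    ∃ P : Measure (T → ℝ), IsProbabilityMeasure P ∧ ∀ A : Finset T,
      P.real {x | ∃ t ∈ A, x t = 1} = θ A / κ := by
  -- Subtracting `1` from `θ / κ` leaves the weights of nonempty sets unchanged and gives `∅` the
  -- missing mass `1 - θ A / κ ≥ 0`. The total mass becomes `-φ ∅ = 1`.
  set φ : Finset T → ℝ := fun A => -(1 - θ A / κ) with hφdef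
  have hw : ∀ A L : Finset T, L.Nonempty → weight φ A L = weight θ A L / κ := fun A L hL => by
    have h1 : φ = fun A => -1 - -θ A / κ := by
      funext A
      simp only [hφdef]
      ring
    have h2 : (fun A => -θ A / κ) = fun A => (fun B => 0 - θ B) A / κ := by
      funext A
      ring
    unfold weight
    rw [h1, iterDelta_const_sub _ _ hL, h2, iterDelta_div, iterDelta_const_sub _ _ hL]
    ring
  have hφ : ∀ A, ∀ L ⊆ A, 0 ≤ weight φ A L := fun A L _ => by
    rcases L.eq_empty_or_nonempty with rfl | hne
    · rw [weight_empty, hφdef, neg_neg, sub_nonneg, div_le_one hκ]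
      exact hb A
    · rw [hw A L hne]
      exact div_nonneg (weight_nonneg hθ A hne) hκ.le
  have hprob : ∀ A, IsProbabilityMeasure (binLaw φ A) := fun A => by
    have h := binLaw_real (hφ A) MeasurableSet.univ
    simp only [Set.mem_univ, if_true, mul_one, sum_weight] at h
    refine ⟨?_⟩
    rw [← ENNReal.toReal_eq_one_iff, ← measureReal_def, h]
    simp [hφdef, hθ.empty]
  obtain ⟨P, hP⟩ := exists_isProjectiveLimit (isProjectiveMeasureFamily_binLaw hφ)
  refine ⟨P, hP.isProbabilityMeasure, fun A => ?_⟩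
  have hS : MeasurableSet {x : A → ℝ | ∃ t, x t = 1} := by
    have : {x : A → ℝ | ∃ t, x t = 1} = ⋃ t, {x | x t = 1} := by ext; simp
    rw [this]
    exact MeasurableSet.iUnion fun t =>
      measurableSet_eq_fun (measurable_pi_apply t) measurable_const
  have hpre : {x : T → ℝ | ∃ t ∈ A, x t = 1} = A.restrict ⁻¹' {x : A → ℝ | ∃ t, x t = 1} := by
    ext x
    simp
  rw [hpre, ← map_measureReal_apply (Finset.measurable_restrict A) hS, hP A,
    binLaw_real (hφ A) hS, ← sum_weight_hit hθ.empty (Finset.Subset.refl A), Finset.sum_div]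
  refine Finset.sum_congr rfl fun L hL => ?_
  have hLA := Finset.mem_powerset.1 hL
  rw [Finset.inter_eq_left.2 hLA]
  rcases L.eq_empty_or_nonempty with rfl | hne
  · simp
  · have hmem : (fun t : A => if (t : T) ∈ L then (1 : ℝ) else 0) ∈ {x : A → ℝ | ∃ t, x t = 1} := by
      obtain ⟨t, ht⟩ := hne
      exact ⟨⟨t, hLA ht⟩, if_pos ht⟩
    rw [if_pos hmem, if_pos hne, hw A L hne]
    ring

end BinaryLaw

/-! ### Max-stability and the Tawn–Molchanov property. -/

section MaxStable

open scoped Classical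

variable {T Ω : Type u} [MeasurableSpace Ω] {P : Measure Ω} {X : T → Ω → ℝ} {θ : Finset T → ℝ}

lemma measureReal_forall_le
    (hE : ∀ (A : Finset T) (y : T → ℝ≥0),
      P.real {ω | ∀ t ∈ A, X t ω * y t ≤ 1} = Real.exp (-exponent θ A y))
    (A : Finset T) (x : T → ℝ) (hx : ∀ t ∈ A, 0 < x t) :
    P.real {ω | ∀ t ∈ A, X t ω ≤ x t} =
      Real.exp (-exponent θ A fun t => (x t)⁻¹.toNNReal) := by
  rw [← hE]
  congr 1
  ext ω
  refine forall₂_congr fun t ht => ?_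
  rw [Real.coe_toNNReal _ (inv_nonneg.2 (hx t ht).le), mul_inv_le_iff₀ (hx t ht), one_mul]

lemma frechet_of_exponent (hθ : IsCompletelyAlternating θ)
    (hE : ∀ (A : Finset T) (y : T → ℝ≥0),
      P.real {ω | ∀ t ∈ A, X t ω * y t ≤ 1} = Real.exp (-exponent θ A y))
    (t : T) (x : ℝ) (hx : 0 < x) : P.real {ω | X t ω ≤ x} = Real.exp (-1 / x) := by
  have h := measureReal_forall_le hE {t} (fun _ => x) fun _ _ => hx
  simp only [Finset.mem_singleton, forall_eq] at h
  rw [h, exponent_const hθ.empty, hθ.singleton, Real.coe_toNNReal _ (inv_nonneg.2 hx.le)]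
  congr 1
  ring

lemma isECF_of_exponent (hθ : IsCompletelyAlternating θ)
    (hE : ∀ (A : Finset T) (y : T → ℝ≥0),
      P.real {ω | ∀ t ∈ A, X t ω * y t ≤ 1} = Real.exp (-exponent θ A y)) : IsECF P X θ where
  empty := hθ.empty
  eq A _ τ hτ := by
    rw [measureReal_forall_le hE A (fun _ => τ) fun _ _ => hτ, Real.log_exp,
      exponent_const hθ.empty, Real.coe_toNNReal _ (inv_nonneg.2 hτ.le)]
    field_simp

lemma measurableSet_forall_le {ι : Type*} [Fintype ι] (a : ι → ℝ) :
    MeasurableSet {x : ι → ℝ | ∀ t, x t ≤ a t} := by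
  have : {x : ι → ℝ | ∀ t, x t ≤ a t} = ⋂ t, {x | x t ≤ a t} := by ext; simp
  rw [this]
  exact MeasurableSet.iInter fun t => measurableSet_le (measurable_pi_apply t) measurable_const

/-- Independence multiplies the exponent by `n`, and rescaling the process multiplies the reciprocal
levels by `n`; the two agree because the exponent is homogeneous of degree one. -/
lemma sameFDD_of_exponent (hX : IsProcess P X) (hθ : IsCompletelyAlternating θ)
    (hE : ∀ (A : Finset T) (y : T → ℝ≥0),
      P.real {ω | ∀ t ∈ A, X t ω * y t ≤ 1} = Real.exp (-exponent θ A y)) (n : ℕ) (hn : 1 ≤ n) :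
    SameFDD (Measure.pi (fun _ : Fin n => P)) (fun t ω => ⨆ i : Fin n, X t (ω i))
      P (fun t ω => (n : ℝ) * X t ω) := fun A => by
  have := hX.prob
  have : Nonempty (Fin n) := ⟨⟨0, hn⟩⟩
  have hn0 : (0 : ℝ) < n := by exact_mod_cast hn
  have hF := frechet_of_exponent hθ hE
  have hm1 : Measurable fun (ω : Fin n → Ω) (t : A) => ⨆ i : Fin n, X t (ω i) :=
    measurable_pi_lambda _ fun t => Measurable.iSup fun i =>
      (hX.meas t).comp (measurable_pi_apply i)
  have hm2 : Measurable fun ω (t : A) => (n : ℝ) * X t ω :=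
    measurable_pi_lambda _ fun t => (hX.meas t).const_mul _
  have hsup : ∀ (t : T) (ω : Fin n → Ω) (c : ℝ),
      (⨆ i : Fin n, X t (ω i)) ≤ c ↔ ∀ i, X t (ω i) ≤ c := fun t ω c =>
    ciSup_le_iff (Set.finite_range _).bddAbove
  have hpi : ∀ S : Set Ω, (Measure.pi fun _ : Fin n => P).real (Set.univ.pi fun _ => S) =
      P.real S ^ n := fun S => by
    simp [measureReal_def, Measure.pi_pi]
  have := Measure.isProbabilityMeasure_map (μ := Measure.pi fun _ : Fin n => P) hm1.aemeasurable
  have := Measure.isProbabilityMeasure_map (μ := P) hm2.aemeasurable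
  refine ⟨hm1.aemeasurable, hm2.aemeasurable, ext_of_pos_orthants (fun t => ?_) (fun t => ?_)
    fun a ha => ?_⟩
  · rw [map_measureReal_apply hm1 (measurableSet_le (measurable_pi_apply t) measurable_const)]
    have : (fun (ω : Fin n → Ω) (t : A) => ⨆ i : Fin n, X t (ω i)) ⁻¹' {x | x t ≤ 0} =
        Set.univ.pi fun _ => {ω | X t ω ≤ 0} := by
      ext ω
      simpa using hsup t ω 0
    rw [this, hpi, measureReal_le_nonpos hX hF t le_rfl, zero_pow (by lia)]
  · rw [map_measureReal_apply hm2 (measurableSet_le (measurable_pi_apply t) measurable_const)]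
    have : (fun ω (t : A) => (n : ℝ) * X t ω) ⁻¹' {x | x t ≤ 0} = {ω | X t ω ≤ 0} := by
      ext ω
      exact ⟨fun h => nonpos_of_mul_nonpos_right h hn0,
        fun h => mul_nonpos_of_nonneg_of_nonpos hn0.le h⟩
    rw [this, measureReal_le_nonpos hX hF t le_rfl]
  · rw [map_measureReal_apply hm1 (measurableSet_forall_le a),
      map_measureReal_apply hm2 (measurableSet_forall_le a)]
    let x : T → ℝ := fun t => if h : t ∈ A then a ⟨t, h⟩ else 1
    have hxa : ∀ t : A, x t = a t := fun t => dif_pos t.2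
    have hx : ∀ t ∈ A, 0 < x t := fun t ht => by
      rw [hxa ⟨t, ht⟩]
      exact ha _
    have e1 : (fun (ω : Fin n → Ω) (t : A) => ⨆ i : Fin n, X t (ω i)) ⁻¹'
        {x | ∀ t, x t ≤ a t} = Set.univ.pi fun _ => {ω | ∀ t ∈ A, X t ω ≤ x t} := by
      ext ω
      simp only [Set.mem_preimage, Set.mem_ofPred_eq, Set.mem_pi, Set.mem_univ, true_imp_iff, hsup]
      exact ⟨fun h i t ht => (h ⟨t, ht⟩ i).trans_eq (hxa ⟨t, ht⟩).symm,
        fun h t i => (h i t t.2).trans_eq (hxa t)⟩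
    have e2 : (fun ω (t : A) => (n : ℝ) * X t ω) ⁻¹' {x | ∀ t, x t ≤ a t} =
        {ω | ∀ t ∈ A, X t ω ≤ x t / n} := by
      ext ω
      simp only [Set.mem_preimage, Set.mem_ofPred_eq, le_div_iff₀' hn0]
      exact ⟨fun h t ht => (h ⟨t, ht⟩).trans_eq (hxa ⟨t, ht⟩).symm,
        fun h t => (h t t.2).trans_eq (hxa t)⟩
    have hscale : (fun t => (x t / n)⁻¹.toNNReal) = fun t => (n : ℝ≥0) * (x t)⁻¹.toNNReal := by
      funext t
      rw [inv_div, div_eq_mul_inv, Real.toNNReal_mul hn0.le, Real.toNNReal_natCast]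
    rw [e1, e2, hpi, measureReal_forall_le hE A x hx,
      measureReal_forall_le hE A (fun t => x t / n) fun t ht => div_pos (hx t ht) hn0, hscale,
      exponent_mul, ← Real.exp_nat_mul, NNReal.coe_natCast, mul_neg]

lemma isSimpleMaxStable_of_exponent (hX : IsProcess P X) (hθ : IsCompletelyAlternating θ)
    (hE : ∀ (A : Finset T) (y : T → ℝ≥0),
      P.real {ω | ∀ t ∈ A, X t ω * y t ≤ 1} = Real.exp (-exponent θ A y)) :
    IsSimpleMaxStable P X where
  process := hX
  frechet := frechet_of_exponent hθ hE
  maxStable := sameFDD_of_exponent hX hθ hE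

lemma isTMProcess_of_exponent (hX : IsProcess P X) (hθ : IsCompletelyAlternating θ)
    (hE : ∀ (A : Finset T) (y : T → ℝ≥0),
      P.real {ω | ∀ t ∈ A, X t ω * y t ≤ 1} = Real.exp (-exponent θ A y)) :
    IsTMProcess P X θ where
  process := hX
  ecf := ⟨Ω, inferInstance, P, X, isSimpleMaxStable_of_exponent hX hθ hE, isECF_of_exponent hθ hE⟩
  fdd A x hx := by
    rw [measureReal_forall_le hE A x hx, exponent, Finset.sum_filter]
    congr 2
    refine Finset.sum_congr rfl fun L hL => ?_
    rcases L.eq_empty_or_nonempty with rfl | hne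
    · simp
    rw [if_pos hne, weight]
    congr 1
    have hxL : ∀ t ∈ L, 0 ≤ (x t)⁻¹ := fun t ht =>
      inv_nonneg.2 (hx t (Finset.mem_powerset.1 hL ht)).le
    have : Nonempty L := hne.to_subtype
    refine le_antisymm ?_ (ciSup_le fun t => ?_)
    · obtain ⟨t, ht, hsup⟩ := Finset.exists_mem_eq_sup L hne fun t => (x t)⁻¹.toNNReal
      rw [hsup, Real.coe_toNNReal _ (hxL t ht)]
      exact le_ciSup (f := fun t : L => (x t)⁻¹) (Set.finite_range _).bddAbove ⟨t, ht⟩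
    · rw [← Real.coe_toNNReal _ (hxL t t.2)]
      exact NNReal.coe_le_coe.2 (Finset.le_sup (f := fun t => (x t)⁻¹.toNNReal) t.2)

end MaxStable

/-! ### Comparison of the classes. -/

section Classes

open scoped Classical

variable {T : Type u}

/-- Extremal coefficient functions are the normalized completely alternating functions. -/
theorem mem_Theta_iff {θ : Finset T → ℝ} : θ ∈ Theta T ↔ IsCompletelyAlternating θ := by
  constructor
  · rintro ⟨Ω, _, P, X, hX, hθ⟩
    exact isCompletelyAlternating_of_ecf hX.process hX.frechet hθ
  · intro hθ
    obtain ⟨P, hX, hE⟩ := exists_tm_law hθ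
    exact (isTMProcess_of_exponent hX hθ hE).ecf

lemma psi_image_Theta_subset :
    psi T '' Theta T ⊆ MAX T ∩ TCFInf T ∩ TM T := by
  rintro _ ⟨θ, hθ, rfl⟩
  rw [mem_Theta_iff] at hθ
  obtain ⟨P, hX, hE⟩ := exists_tm_law hθ
  have hF := frechet_of_exponent hθ hE
  have hχ := hasTCF_of_ecf hX hF (isECF_of_exponent hθ hE)
  exact ⟨⟨⟨_, _, P, _, isSimpleMaxStable_of_exponent hX hθ hE, hχ⟩,
    ⟨_, _, P, _, hX, hχ, upperEndpoint_of_frechet hX hF⟩⟩,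
    ⟨_, _, P, _, θ, isTMProcess_of_exponent hX hθ hE, hχ⟩⟩

lemma integral_binary {Ω : Type u} [MeasurableSpace Ω] {P : Measure Ω} {Z : Ω → ℝ}
    (hZ : Measurable Z) (h01 : ∀ ω, Z ω = 0 ∨ Z ω = 1) :
    ∫ ω, Z ω ∂P = P.real {ω | Z ω = 1} := by
  rw [← integral_indicator_one (measurableSet_eq_fun hZ measurable_const)]
  refine integral_congr_ae (ae_of_all _ fun ω => ?_)
  rcases h01 ω with h | h <;> simp [h]

/-- Inclusion–exclusion for two events of equal probability `p`. -/
lemma psi_eq_cond {Ω : Type u} [MeasurableSpace Ω] {P : Measure Ω} [IsFiniteMeasure P]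
    {E : T → Set Ω} (hE : ∀ t, MeasurableSet (E t)) {p : ℝ} (hp : p ≠ 0)
    (hEp : ∀ t, P.real (E t) = p) :
    psi T (fun A => P.real {ω | ∃ t ∈ A, ω ∈ E t} / p) =
      fun q => (P[|E q.2]).real (E q.1) := by
  funext ⟨s, t⟩
  simp only [psi]
  have hU : {ω | ∃ r ∈ ({s, t} : Finset T), ω ∈ E r} = E t ∪ E s := by
    ext ω
    simp [or_comm]
  have h := measureReal_union_add_inter (μ := P) (s := E t) (hE s)
  rw [measureReal_cond (hE t), hU, hEp t]
  rw [hEp, hEp] at h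
  field_simp
  linarith

theorem BIN_eq_psi_image_ThetaB : BIN T = psi T '' ThetaB T := by
  ext f
  constructor
  · rintro ⟨Ω, _, P, Y, hY, hid, h01, hne, rfl⟩
    have := hY.prob
    have hE : ∀ t, MeasurableSet {ω | Y t ω = 1} := fun t =>
      measurableSet_eq_fun (hY.meas t) measurable_const
    -- With `T` empty there is no common success probability to divide by, but any admissible `θ`
    -- serves.
    rcases isEmpty_or_nonempty T with hT | ⟨⟨t₀⟩⟩
    · refine ⟨fun A => A.card, ⟨mem_Theta_iff.2 isCompletelyAlternating_card, 0, fun A => ?_⟩,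
        funext fun q => hT.elim q.1⟩
      simp [Finset.eq_empty_of_isEmpty A]
    set p := P.real {ω | Y t₀ ω = 1} with hpdef
    have hp : 0 < p := lt_of_le_of_ne measureReal_nonneg
      (by rw [hpdef, ← integral_binary (hY.meas t₀) (h01 t₀)]; exact (hne t₀).symm)
    have hEp : ∀ t, P.real {ω | Y t ω = 1} = p := fun t => by
      have := (hid t t₀).measure_mem_eq (measurableSet_singleton (1 : ℝ))
      exact congrArg ENNReal.toReal this
    refine ⟨_, ⟨mem_Theta_iff.2 ⟨?_, fun t => ?_, fun L K hL _ => ?_⟩, 1 / p, fun A => ?_⟩,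
      psi_eq_cond hE hp.ne' hEp⟩
    · simp
    · have : {ω | ∃ r ∈ ({t} : Finset T), ω ∈ {ω | Y r ω = 1}} = {ω | Y t ω = 1} := by
        ext ω
        simp
      rw [this, hEp, div_self hp.ne']
    · rw [iterDelta_div]
      exact div_nonpos_of_nonpos_of_nonneg (iterDelta_measure_nonpos P hE hL K) hp.le
    · rw [abs_of_nonneg (div_nonneg measureReal_nonneg hp.le)]
      gcongr
      exact measureReal_le_one
  · rintro ⟨θ, ⟨hθ, κ, hκ⟩, rfl⟩
    rw [mem_Theta_iff] at hθ
    have hκ' : (0 : ℝ) < max κ 1 := lt_max_of_lt_right one_pos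
    obtain ⟨P, hP, hθP⟩ := exists_bin_law hθ hκ'
      fun A => (le_abs_self _).trans ((hκ A).trans (le_max_left _ _))
    have hE : ∀ t, MeasurableSet {x : T → ℝ | x t = 1} := fun t =>
      measurableSet_eq_fun (measurable_pi_apply t) measurable_const
    have hEp : ∀ t, P.real {x : T → ℝ | x t = 1} = 1 / max κ 1 := fun t => by
      have := hθP {t}
      simp only [Finset.mem_singleton, exists_eq_left, hθ.singleton] at this
      exact this
    -- The coordinates are `{0,1}`-valued only almost surely, whereas `BIN` demands it at every
    -- point.
    let Y : T → (T → ℝ) → ℝ := fun t => Set.indicator {x | x t = 1} 1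
    have hY : ∀ t, Measurable (Y t) := fun t => measurable_one.indicator (hE t)
    have hY1 : ∀ t, {x | Y t x = 1} = {x | x t = 1} := fun t => by
      ext x
      by_cases hx : x t = 1 <;> simp [Y, hx]
    have h01 : ∀ t x, Y t x = 0 ∨ Y t x = 1 := fun t x => by
      by_cases hx : x t = 1 <;> simp [Y, hx]
    refine ⟨_, _, P, Y, ⟨hP, hY⟩, fun s t => ⟨(hY s).aemeasurable, (hY t).aemeasurable, ?_⟩, h01,
      fun t => ?_, ?_⟩
    · ext S hS
      rw [Measure.map_apply (hY s) hS, Measure.map_apply (hY t) hS]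
      have hpre : ∀ t, Y t ⁻¹' S = {x | x t = 1} ∩ {_x | (1 : ℝ) ∈ S} ∪
          {x | x t = 1}ᶜ ∩ {_x | (0 : ℝ) ∈ S} := fun t => by
        ext x
        by_cases hx : x t = 1 <;> simp [Y, hx]
      have hst : P {x : T → ℝ | x s = 1} = P {x : T → ℝ | x t = 1} := by
        rw [← measureReal_eq_measureReal_iff, hEp, hEp]
      rw [hpre, hpre]
      by_cases h1 : (1 : ℝ) ∈ S <;> by_cases h0 : (0 : ℝ) ∈ S <;>
        simp [h1, h0, prob_compl_eq_one_sub (hE _), hst]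
    · rw [integral_binary (hY t) (h01 t), hY1, hEp]
      positivity
    · simp only [hY1]
      rw [← psi_eq_cond hE (one_div_pos.2 hκ').ne' hEp]
      congr 1
      funext A
      simp only [Set.mem_ofPred_eq]
      rw [hθP]
      field_simp

lemma upperEndpoint_ne_bot {Ω : Type u} [MeasurableSpace Ω] {P : Measure Ω}
    [IsProbabilityMeasure P] (Z : Ω → ℝ) : upperEndpoint P Z ≠ ⊥ := fun h => by
  have hae : ∀ᵐ ω ∂P, False := by
    filter_upwards [ae_le_essSup (μ := P) (f := fun ω => (Z ω : EReal))] with ω hω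
    rw [show essSup (fun ω => (Z ω : EReal)) P = ⊥ from h, le_bot_iff] at hω
    exact EReal.coe_ne_bot _ hω
  exact (hae.exists).choose_spec

/-- Reals are dense in `EReal`; only for the endpoint `⊥` are there no thresholds below. -/
lemma belowEndpoint_neBot {e : EReal} (he : e ≠ ⊥) : (belowEndpoint e).NeBot := by
  rw [belowEndpoint, comap_neBot_iff]
  intro S hS
  obtain ⟨l, hl, hlS⟩ := (mem_nhdsLT_iff_exists_Ioo_subset' (bot_lt_iff_ne_bot.2 he)).1 hS
  obtain ⟨x, hlx, hxe⟩ := EReal.lt_iff_exists_real_btwn.1 hl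
  exact ⟨x, hlS ⟨hlx, hxe⟩⟩

lemma measure_gt_ne_zero {Ω : Type u} [MeasurableSpace Ω] {P : Measure Ω} {Z : Ω → ℝ} {τ : ℝ}
    (h : (τ : EReal) < upperEndpoint P Z) : P {ω | τ < Z ω} ≠ 0 := fun h0 => by
  refine h.not_ge (essSup_le_of_ae_le _ ?_)
  filter_upwards [compl_mem_ae_iff.2 h0] with ω hω
  exact EReal.coe_le_coe_iff.2 (not_lt.1 hω)

lemma cond_gt_mem_BIN {Ω : Type u} [MeasurableSpace Ω] {P : Measure Ω} {X : T → Ω → ℝ}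
    (hX : IsProcess P X) (hid : IdenticalMargins P X) {τ : ℝ}
    (hτ : ∀ t, P {ω | τ < X t ω} ≠ 0) :
    (fun q : T × T => (P[|{ω | τ < X q.2 ω}]).real {ω | τ < X q.1 ω}) ∈ BIN T := by
  have := hX.prob
  let g : ℝ → ℝ := Set.indicator (Set.Ioi τ) 1
  have hg : Measurable g := measurable_one.indicator measurableSet_Ioi
  have h1 : ∀ t, {ω | g (X t ω) = 1} = {ω | τ < X t ω} := fun t => by
    ext ω
    by_cases h : τ < X t ω <;> simp [g, h]
  have h01 : ∀ t ω, g (X t ω) = 0 ∨ g (X t ω) = 1 := fun t ω => by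
    by_cases h : τ < X t ω <;> simp [g, h]
  have hm : ∀ t, Measurable fun ω => g (X t ω) := fun t => hg.comp (hX.meas t)
  refine ⟨Ω, _, P, fun t ω => g (X t ω), ⟨hX.prob, hm⟩, fun s t => (hid s t).comp hg, h01,
    fun t => ?_, ?_⟩
  · rw [integral_binary (hm t) (h01 t), h1]
    exact (measureReal_ne_zero_iff).2 (hτ t)
  · simp only [h1]

theorem TCF_subset_seqClosure : TCF T ⊆ seqClosure (BIN T) := by
  rintro χ ⟨Ω, _, P, X, hX, hχ⟩
  have := hX.prob
  rcases isEmpty_or_nonempty T with hT | ⟨⟨t₀⟩⟩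
  · refine subset_seqClosure ?_
    convert cond_gt_mem_BIN hX hχ.margins (τ := 0) fun t => hT.elim t
    exact hT.elim ‹T × T›.1
  set e := upperEndpoint P (X t₀) with he
  have het : ∀ t, upperEndpoint P (X t) = e := fun t => by
    have h : ∀ t, upperEndpoint P (X t) = essSup (fun x : ℝ => (x : EReal)) (P.map (X t)) :=
      fun t => (essSup_map_measure measurable_coe_real_ereal.aemeasurable
        (hX.meas t).aemeasurable).symm
    rw [he, h, h, (hχ.margins t t₀).map_eq]
  have := belowEndpoint_neBot (upperEndpoint_ne_bot (P := P) (X t₀))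
  have : (belowEndpoint e).IsCountablyGenerated := by
    unfold belowEndpoint
    infer_instance
  have hlt : ∀ᶠ τ in belowEndpoint e, ((τ : ℝ) : EReal) < e :=
    (eventually_mem_nhdsWithin (s := Set.Iio e)).comap _
  -- Countable generation yields a sequence of thresholds, and staying strictly below `e` gives
  -- every conditioning event positive probability.
  obtain ⟨τ, hτ, hτe⟩ := exists_seq_forall_of_frequently hlt.frequently
  refine ⟨fun n q => (P[|{ω | τ n < X q.2 ω}]).real {ω | τ n < X q.1 ω}, fun n =>
    cond_gt_mem_BIN hX hχ.margins fun t => measure_gt_ne_zero ((het t).symm ▸ hτe n), ?_⟩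
  refine tendsto_pi_nhds.2 fun q => ?_
  have h := hχ.tendsto q.1 q.2
  rw [het] at h
  exact h.comp hτ

lemma isClosed_psi_image_Theta : IsClosed (psi T '' Theta T) := by
  have : Theta T = {θ | IsCompletelyAlternating θ} := Set.ext fun _ => mem_Theta_iff
  rw [this]
  exact isClosed_psi_image

lemma closure_BIN_subset : closure (BIN T) ⊆ psi T '' Theta T := by
  refine closure_minimal ?_ isClosed_psi_image_Theta
  rw [BIN_eq_psi_image_ThetaB]
  exact Set.image_mono fun _ h => h.1

/-- `2 - |{s, t}|` is the indicator of the diagonal. A binary process realizing it would give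
infinitely many almost disjoint events of the same positive probability. -/
lemma psi_card_notMem_BIN [Infinite T] : psi T (fun A => (A.card : ℝ)) ∉ BIN T := by
  rintro ⟨Ω, _, P, Y, hY, hid, h01, hne, hf⟩
  have := hY.prob
  have hE : ∀ t, MeasurableSet {ω | Y t ω = 1} := fun t =>
    measurableSet_eq_fun (hY.meas t) measurable_const
  obtain ⟨t₀⟩ := (inferInstance : Nonempty T)
  have hEp : ∀ t, P {ω | Y t ω = 1} = P {ω | Y t₀ ω = 1} := fun t =>
    (hid t t₀).measure_mem_eq (measurableSet_singleton (1 : ℝ))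
  have hp : P {ω | Y t₀ ω = 1} ≠ 0 := fun h => hne t₀ <| by
    rw [integral_binary (hY.meas t₀) (h01 t₀), measureReal_def, h, ENNReal.toReal_zero]
  have hdisj : Pairwise (Function.onFun (AEDisjoint P) fun t => {ω | Y t ω = 1}) := fun s t hst => by
    have h := congrFun hf (s, t)
    simp only [psi] at h
    rw [Finset.card_pair hst, measureReal_cond (hE t), Nat.cast_ofNat, sub_self, eq_comm,
      div_eq_zero_iff] at h
    rcases h with h | h
    · have := (measureReal_eq_zero_iff).1 h
      rwa [Set.inter_comm] at this
    · exact absurd ((measureReal_eq_zero_iff).1 h) (by rw [hEp]; exact hp)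
  have hfin := Measure.finite_const_le_meas_of_disjoint_iUnion₀ P (pos_iff_ne_zero.2 hp)
    (fun t => (hE t).nullMeasurableSet) hdisj (measure_ne_top _ _)
  simp only [hEp, le_refl] at hfin
  exact Set.infinite_univ hfin

end Classes

end TailCorrelation

/-! ### The cycle of inclusions. -/

theorem mainTheorem1 (T : Type u) :
    (TailCorrelation.BIN T = TailCorrelation.psi T '' TailCorrelation.ThetaB T ∧
      TailCorrelation.TCF T = TailCorrelation.TCFInf T ∧
      TailCorrelation.TCF T = TailCorrelation.MAX T ∧
      TailCorrelation.TCF T = TailCorrelation.TM T ∧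
      TailCorrelation.TCF T = TailCorrelation.psi T '' TailCorrelation.Theta T ∧
      TailCorrelation.TCF T = seqClosure (TailCorrelation.BIN T) ∧
      TailCorrelation.TCF T = closure (TailCorrelation.BIN T)) ∧
    (Infinite T → TailCorrelation.BIN T ⊂ TailCorrelation.TCF T) ∧
    (Finite T → TailCorrelation.BIN T = TailCorrelation.TCF T) := by
  open TailCorrelation in
  have h1 : TCF T ⊆ seqClosure (BIN T) := TCF_subset_seqClosure
  have h2 : seqClosure (BIN T) ⊆ closure (BIN T) := seqClosure_subset_closure
  have h3 : closure (BIN T) ⊆ psi T '' Theta T := closure_BIN_subset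
  have h4 := psi_image_Theta_subset (T := T)
  have hInf : TCFInf T ⊆ TCF T := fun _ ⟨Ω, m, P, X, hX, hχ, _⟩ => ⟨Ω, m, P, X, hX, hχ⟩
  have hMax : MAX T ⊆ TCF T := fun _ ⟨Ω, m, P, X, hX, hχ⟩ => ⟨Ω, m, P, X, hX.process, hχ⟩
  have hTM : TM T ⊆ TCF T := fun _ ⟨Ω, m, P, X, _, hX, hχ⟩ => ⟨Ω, m, P, X, hX.process, hχ⟩
  have h5 : psi T '' Theta T ⊆ TCF T := fun _ h => hMax (h4 h).1.1
  have h6 : TCF T ⊆ psi T '' Theta T := h1.trans (h2.trans h3)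
  have hB : BIN T ⊆ TCF T := subset_closure.trans (h3.trans h5)
  refine ⟨⟨BIN_eq_psi_image_ThetaB, ?_, ?_, ?_, h6.antisymm h5, ?_, ?_⟩, fun _ => ?_, fun _ => ?_⟩
  · exact Set.Subset.antisymm (fun _ h => (h4 (h6 h)).1.2) hInf
  · exact Set.Subset.antisymm (fun _ h => (h4 (h6 h)).1.1) hMax
  · exact Set.Subset.antisymm (fun _ h => (h4 (h6 h)).2) hTM
  · exact h1.antisymm (h2.trans (h3.trans h5))
  · exact (h1.trans h2).antisymm (h3.trans h5)
  · refine LE.le.ssubset_of_not_superset hB fun h => psi_card_notMem_BIN (h (h5 ?_))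
    exact ⟨_, mem_Theta_iff.2 isCompletelyAlternating_card, rfl⟩
  · refine hB.antisymm (h6.trans ?_)
    rw [BIN_eq_psi_image_ThetaB]
    refine Set.image_mono fun θ hθ => ⟨hθ, ?_⟩
    -- A finite `T` has only finitely many subsets.
    obtain ⟨κ, hκ⟩ := (Set.finite_range fun A => |θ A|).bddAbove
    exact ⟨κ, fun A => hκ ⟨A, rfl⟩⟩
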